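/- **Lemma 4.1 (Normal form).** Let $n,N,m\ge 0$ be integers. Points of $\mathbb C^{2n}\times\mathbb C^{2N}$ are written $(z,\zeta)$ with $z=(x_j,y_j)_{1\le j\le n}$ and $\zeta=(\xi_j,\eta_j)_{1\le j\le N}$; all vectors carry the Euclidean (Hermitian) norm $|\cdot|$, in particular $|(z,\zeta)|^2=|z|^2+|\zeta|^2$. Let $I=I(z)=(I_1,\dots,I_n)$ with $I_j=\tfrac12(x_j^2+y_j^2)\in\mathbb C$; let $I^0\in\mathbb R^n$, and for vectors in $\mathbb C^n$ put $|I-I^0|=\sum_{j}|I_j-I^0_j|$ and let $\langle\cdot,\cdot\rangle$ be the complex bilinear product $\langle u,v\rangle=\sum_j u_jv_j$. For a real $n\times n$ matrix, $\|A\|$ is the operator norm with respect to the $\ell^1$-norm. For $a,b,c>0$ let $$\mathcal D_{a,b,c}=\{(z,\zeta)\in\mathbb C^{2n}\times\mathbb C^{2N}:\ |I-I^0|<a,\ |z|<b,\ |\zeta|<c\},$$ and for $\underline r=(r_1,r_2,r_3)$ write $\mathcal D_{\underline r}=\mathcal D_{r_1,r_2,r_3}$ and let $|\cdot|_{\underline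 r}$ be the supremum norm over $\mathcal D_{\underline r}$. A map on a subset of a complex vector space is called real analytic if it is complex analytic and maps real vectors to real vectors. The Poisson bracket is $\{F,G\}=\sum_j(\partial_{x_j}F\,\partial_{y_j}G-\partial_{y_j}F\,\partial_{x_j}G)+\sum_j(\partial_{\xi_j}F\,\partial_{\eta_j}G-\partial_{\eta_j}F\,\partial_{\xi_j}G)$. A real analytic symplectic transformation on an open set is an injective real analytic map whose derivative at every point preserves the form $\sum_j dx_j\wedge dy_j+\sum_j d\xi_j\wedge d\eta_j$. Let $\omega^0\in\mathbb R^n$, let $A\in\mathbb R^{n\times n}$ be symmetric, let $T,\kappa>0$ with $T\omega^0\in2\pi\mathbb Z^n$, let $r_1,r_2,r_3>0$, and put $h=\langle\omega^0,I\rangle$. Consider $$H(z,\zeta)=\langle\omega^0,I\rangle+\tfrac12\langle A(I-I^0),I-I^0\rangle+g(z,\zeta)+f(z,\zeta)+\kappa\Lambda(\zeta),$$ where $g$ and $f$ are real analytic scalar functions on an open neighbourhood of $\overline{\mathcal D_{3\underline r}}$ and $\Lambda$ is a real analytic scalar function on an open neighbourhood of $\{\zeta\in\mathbb C^{2N}:|\zeta|\le3r_3\}$.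 Suppose that for some $\delta,\varepsilon>0$ and $C_\Lambda>0$: 1. $|g|_{3\underline r}\le\delta$ and $\{g,h\}=0$ on $\mathcal D_{3\underline r}$; 2. $|f|_{3\underline r}\le\varepsilon$; 3. $|D\Lambda(\zeta)|\le C_\Lambda|\zeta|$ for all $\zeta\in\mathbb C^{2N}$ with $|\zeta|\le3r_3$; 4. $r_1<2r_2^2$ and $r_1<2r_2r_3$; 5. $\displaystyle m^2\varepsilon T<\frac{r_1^2}{81\,r_2^2}$; 6. $\displaystyle 54\,m\|A\|r_1T+\frac{324(\delta+2\varepsilon)m^2r_2^2T}{r_1^2}+\frac{9\kappa C_\Lambda mT}{2}\le\frac12$. Then there exist a real analytic symplectic transformation $\Psi:\mathcal D_{2\underline r}\to\mathcal D_{3\underline r}$ and real analytic scalar functions $\hat g,\hat f$ on $\mathcal D_{2\underline r}$ such that, on $\mathcal D_{2\underline r}$, $$H\circ\Psi=\langle\omega^0,I\rangle+\tfrac12\langle A(I-I^0),I-I^0\rangle+\hat g(z,\zeta)+\hat f(z,\zeta)+\kappa\Lambda(\zeta),$$ and (a) $\displaystyle|\Psi-\mathrm{id}|_{2\underline r}\le\frac{18\,m\,r_2}{r_1}\,\varepsilon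 T$; (b) $|\hat g|_{2\underline r}\le\delta+2\varepsilon$ and $\{\hat g,h\}=0$ on $\mathcal D_{2\underline r}$; (c) $|\hat f|_{2\underline r}\le2^{-m}\varepsilon$. -/

import Mathlib

/-- The complexified phase space `ℂ^{2k}` with its Euclidean (Hermitian) norm, for `k` conjugate
pairs indexed by `ι`: the pair of index `j` of a vector `w` is `(w (j, 0), w (j, 1))`. -/
abbrev Darboux (ι : Type) [Fintype ι] : Type := EuclideanSpace ℂ (ι × Fin 2)

/-- The space `ℂ^{2n} × ℂ^{2N}` of points `(z, ζ)` with its Euclidean norm. The pairs of index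
`Sum.inl j` are `(x_j, y_j)` and make up `z`, those of index `Sum.inr j` are `(ξ_j, η_j)` and make
up the transverse component `ζ`. -/
abbrev Phase (n N : ℕ) : Type := Darboux (Fin n ⊕ Fin N)

/-- The component `z` of `(z, ζ)`. -/
noncomputable def zPart {n N : ℕ} (p : Phase n N) : Darboux (Fin n) :=
  WithLp.toLp 2 fun i => p (Sum.inl i.1, i.2)

/-- The component `ζ` of `(z, ζ)`. -/
noncomputable def ζPart {n N : ℕ} (p : Phase n N) : Darboux (Fin N) :=
  WithLp.toLp 2 fun i => p (Sum.inr i.1, i.2)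

/-- The vectors of `ℂ^{2k}` with real coordinates. -/
def realVectors (ι : Type) [Fintype ι] : Set (Darboux ι) := {w | ∀ i, (w i).im = 0}

/-- The real numbers inside `ℂ`. -/
def realScalars : Set ℂ := {w | w.im = 0}

/-- `f` is real analytic on `U`: complex analytic, and mapping real vectors (`RE`) to real
vectors (`RF`). -/
def RealAnalyticOn {E F : Type*} [NormedAddCommGroup E] [NormedSpace ℂ E]
    [NormedAddCommGroup F] [NormedSpace ℂ F] (RE : Set E) (RF : Set F)
    (f : E → F) (U : Set E) : Prop :=
  AnalyticOnNhd ℂ f U ∧ Set.MapsTo f (U ∩ RE) RF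

/-- `f` is real analytic on some open set containing `S`. -/
def RealAnalyticNear {E F : Type*} [NormedAddCommGroup E] [NormedSpace ℂ E]
    [NormedAddCommGroup F] [NormedSpace ℂ F] (RE : Set E) (RF : Set F)
    (f : E → F) (S : Set E) : Prop :=
  ∃ U : Set E, IsOpen U ∧ S ⊆ U ∧ RealAnalyticOn RE RF f U

/-- The actions `I_j = (x_j² + y_j²) / 2`, complex valued. -/
noncomputable def actions {n : ℕ} (z : Darboux (Fin n)) : Fin n → ℂ :=
  fun j => (z (j, 0) ^ 2 + z (j, 1) ^ 2) / 2

/-- `I - I⁰` as a function of `z`. -/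
noncomputable def actionDev {n : ℕ} (I₀ : Fin n → ℝ) (z : Darboux (Fin n)) : Fin n → ℂ :=
  fun j => actions z j - (I₀ j : ℂ)

/-- The domain `D_{a,b,c}`: `|I - I⁰| < a` in the `l¹` norm, `|z| < b` and `|ζ| < c`. -/
def dom {n N : ℕ} (I₀ : Fin n → ℝ) (a b c : ℝ) : Set (Phase n N) :=
  {p | ∑ j, ‖actionDev I₀ (zPart p) j‖ < a ∧ ‖zPart p‖ < b ∧ ‖ζPart p‖ < c}

/-- The supremum norm of `G` over `S` is at most `C`. -/
def SupNormLE {E F : Type*} [NormedAddCommGroup F] (G : E → F) (S : Set E) (C : ℝ) : Prop :=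
  ∀ p ∈ S, ‖G p‖ ≤ C

/-- The operator norm of a real matrix with respect to the `l¹` norm. -/
noncomputable def l1OpNorm {n : ℕ} (A : Matrix (Fin n) (Fin n) ℝ) : ℝ :=
  ‖LinearMap.toContinuousLinearMap (Matrix.toLpLin 1 1 A)‖

/-- The Hamiltonian `h = ⟨ω⁰, I⟩`, as a function of `(z, ζ)`. -/
noncomputable def linHam {n N : ℕ} (ω₀ : Fin n → ℝ) (p : Phase n N) : ℂ :=
  ∑ j, (ω₀ j : ℂ) * actions (zPart p) j

/-- `½ ⟨A (I - I⁰), I - I⁰⟩`, where `⟨·, ·⟩` is complex bilinear. -/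
noncomputable def quadHam {n N : ℕ} (I₀ : Fin n → ℝ) (A : Matrix (Fin n) (Fin n) ℝ)
    (p : Phase n N) : ℂ :=
  (1 / 2) * ∑ i, ∑ j, (A i j : ℂ) * actionDev I₀ (zPart p) j * actionDev I₀ (zPart p) i

/-- `H = ⟨ω⁰, I⟩ + ½ ⟨A (I - I⁰), I - I⁰⟩ + g + f + κ Λ(ζ)`. -/
noncomputable def hamiltonian {n N : ℕ} (ω₀ I₀ : Fin n → ℝ) (A : Matrix (Fin n) (Fin n) ℝ)
    (κ : ℝ) (Λ : Darboux (Fin N) → ℂ) (g f : Phase n N → ℂ) (p : Phase n N) : ℂ :=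
  linHam ω₀ p + quadHam I₀ A p + g p + f p + (κ : ℂ) * Λ (ζPart p)

/-- The partial derivative of `F` in the direction of the coordinate `i`. -/
noncomputable def partialDeriv {ι : Type} [Fintype ι] [DecidableEq ι] (F : Darboux ι → ℂ)
    (i : ι × Fin 2) (p : Darboux ι) : ℂ :=
  fderiv ℂ F p (EuclideanSpace.single i 1)

/-- The Poisson bracket `{F, G} = ∑ (∂F/∂q_j ∂G/∂p_j - ∂F/∂p_j ∂G/∂q_j)`, summed over all
conjugate pairs `(q_j, p_j)`; on `Phase n N` these are the `(x_j, y_j)` and the `(ξ_j, η_j)`. -/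
noncomputable def poisson {ι : Type} [Fintype ι] [DecidableEq ι] (F G : Darboux ι → ℂ)
    (p : Darboux ι) : ℂ :=
  ∑ j : ι, (partialDeriv F (j, 0) p * partialDeriv G (j, 1) p
    - partialDeriv F (j, 1) p * partialDeriv G (j, 0) p)

/-- The symplectic form `∑ dq_j ∧ dp_j`, summed over all conjugate pairs. -/
noncomputable def sympForm {ι : Type} [Fintype ι] (u v : Darboux ι) : ℂ :=
  ∑ j : ι, (u (j, 0) * v (j, 1) - u (j, 1) * v (j, 0))

/-- `Ψ` is a real analytic symplectic transformation on `S`: real analytic, injective (hence, its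
derivative being invertible, a biholomorphic change of variables onto its image if `S` is open),
with derivative preserving the symplectic form. -/
structure IsSymplecticTransformation {ι : Type} [Fintype ι] (Ψ : Darboux ι → Darboux ι)
    (S : Set (Darboux ι)) : Prop where
  realAnalytic : RealAnalyticOn (realVectors ι) (realVectors ι) Ψ S
  injOn : Set.InjOn Ψ S
  symplectic : ∀ p ∈ S, ∀ u v : Darboux ι,
    sympForm (fderiv ℂ Ψ p u) (fderiv ℂ Ψ p v) = sympForm u v

/-!
The proof is a finite iteration of an averaging step. Since `T ω⁰ ∈ 2πℤⁿ`, the flow `R_t` of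
`h = ⟨ω⁰, I⟩` is `T`-periodic, so the homological equation `{χ, h} = f - f₀`, with `f₀` the average
of `f` along this flow, is solved by `χ = T⁻¹ ∫₀ᵀ (t - T / 2) f ∘ R_t dt`, without small divisors
and with `|χ| ≤ ε T / 2` (`exists_homological_solution`). Let `Φ^t` be the Hamiltonian flow of `χ`.
Then `H ∘ Φ¹ = h + ½⟨A(I - I⁰), I - I⁰⟩ + g + f₀ + κΛ + f'`, where `f'` is the integral
over `t ∈ [0, 1]` of `{½⟨A(I - I⁰), I - I⁰⟩ + g + (1 - t) f₀ + t f + κΛ, χ} ∘ Φ^t`. The smallness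
condition makes `|f'| ≤ ε / 2` on a domain smaller by the fraction `1 / m` of `r`
(`exists_averaging_step`). After `m` steps the perturbation is at most `2⁻ᵐ ε`; the
displacements and the averages add up to geometric series.

The three parts of the bracket are estimated by Cauchy's inequality in different directions. For `g`
and `f` all directions are used, with the distance `τ r₁ / (3 r₂)` between two consecutive domains
(`add_mem_dom`). For the quadratic part, only the derivatives of `χ` along rotations of the planes
`(x_j, y_j)` enter; these are estimated along rotations by complex angles, which do not change the
actions (`norm_fderiv_rotGen_le`). For `Λ`, only derivatives in `ζ` enter
(`norm_ζPart_hamField_le`).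

Analyticity in several variables rests on Osgood's lemma (`LineHolomorphicOn.analyticOnNhd`): a
continuous function on an open set of a finite-dimensional space that is holomorphic along complex
lines is analytic, also when its values lie in a Banach space. Applied to maps into spaces `C(K, F)`
of continuous functions of a parameter, it yields the analyticity of integrals with holomorphic
integrand and their differentiation under the integral. The flow is the uniform limit of
its Picard iterates, hence holomorphic in the initial point (`IsSlowField.exists_flow`), and it is
symplectic because its derivative solves the variational equation (`IsFlow.sympForm_fderiv`).
-/

/-! ### Osgood's lemma and holomorphic dependence of integrals -/

/-- `f` is continuous on `U` and holomorphic along every complex line through a point of `U`. -/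
def LineHolomorphicOn {E F : Type*} [NormedAddCommGroup E] [NormedSpace ℂ E]
    [NormedAddCommGroup F] [NormedSpace ℂ F] (f : E → F) (U : Set E) : Prop :=
  ContinuousOn f U ∧ ∀ x ∈ U, ∀ v : E, DifferentiableAt ℂ (fun t : ℂ => f (x + t • v)) 0

section Osgood

universe v

variable {E : Type*} [NormedAddCommGroup E] [NormedSpace ℂ E]
  {F : Type*} [NormedAddCommGroup F] [NormedSpace ℂ F]

lemma DifferentiableOn.lineHolomorphicOn {f : E → F} {U : Set E} (hU : IsOpen U)
    (hf : DifferentiableOn ℂ f U) : LineHolomorphicOn f U := by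
  refine ⟨hf.continuousOn, fun x hx v => ?_⟩
  have h1 : DifferentiableAt ℂ f (x + (0 : ℂ) • v) := by
    simpa using hf.differentiableAt (hU.mem_nhds hx)
  exact DifferentiableAt.comp (𝕜 := ℂ) (0 : ℂ) (g := f) (f := fun t : ℂ => x + t • v) h1
    (by fun_prop)

lemma LineHolomorphicOn.differentiableAt_line {f : E → F} {U : Set E}
    (hf : LineHolomorphicOn f U) {x v : E} {t : ℂ} (h : x + t • v ∈ U) :
    DifferentiableAt ℂ (fun s : ℂ => f (x + s • v)) t := by
  have h1 := hf.2 _ h v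
  have h2 : (fun s : ℂ => f (x + s • v)) = (fun s : ℂ => f (x + t • v + s • v)) ∘ fun s => s - t := by
    funext s
    simp only [Function.comp]
    congr 1
    module
  rw [h2]
  refine DifferentiableAt.comp t ?_ (by fun_prop)
  simpa using h1

/-- A continuous map into `C(K, F)` is line-holomorphic as soon as all its evaluations are: the
Cauchy formula holds in `C(K, F)` because it holds pointwise. -/
lemma lineHolomorphicOn_of_eval [CompleteSpace F] {K : Type*} [TopologicalSpace K]
    [CompactSpace K] {G : E → C(K, F)} {U : Set E} (hU : IsOpen U) (hG : ContinuousOn G U)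
    (h : ∀ k, LineHolomorphicOn (fun x => G x k) U) : LineHolomorphicOn G U := by
  refine ⟨hG, fun x hx v => ?_⟩
  have hline : Continuous fun t : ℂ => x + t • v := by fun_prop
  obtain ⟨R, hR, hRU⟩ : ∃ R > 0, Metric.closedBall (0 : ℂ) R ⊆ (fun t : ℂ => x + t • v) ⁻¹' U :=
    Metric.nhds_basis_closedBall.mem_iff.1 ((hU.preimage hline).mem_nhds (by simpa using hx))
  have hcont : ContinuousOn (fun t : ℂ => G (x + t • v)) (Metric.closedBall 0 R) :=
    hG.comp hline.continuousOn hRU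
  have hci : CircleIntegrable (fun t : ℂ => G (x + t • v)) 0 R :=
    (hcont.mono Metric.sphere_subset_closedBall).circleIntegrable hR.le
  lift R to NNReal using hR.le
  have hps := hasFPowerSeriesOn_cauchy_integral hci (by exact_mod_cast hR)
  have hd := hps.hasFPowerSeriesAt.analyticAt.differentiableAt
  refine hd.congr_of_eventuallyEq ?_
  filter_upwards [Metric.ball_mem_nhds (0 : ℂ) hR] with t ht
  ext k
  have hci' : CircleIntegrable (fun z : ℂ => (z - t)⁻¹ • G (x + z • v)) 0 R := by
    refine ContinuousOn.circleIntegrable hR.le ?_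
    refine ContinuousOn.smul (f := fun z : ℂ => (z - t)⁻¹) ?_
      (hcont.mono Metric.sphere_subset_closedBall)
    refine ContinuousOn.inv₀ (by fun_prop) ?_
    intro z hz h0
    rw [sub_eq_zero.1 h0] at hz
    simp only [Metric.mem_ball, Metric.mem_sphere] at ht hz
    exact ht.ne hz
  have hev : (∮ z in C(0, R), (z - t)⁻¹ • G (x + z • v)) k
      = ∮ z in C(0, R), (z - t)⁻¹ • (G (x + z • v) k) := by
    have := ContinuousLinearMap.intervalIntegral_comp_comm
      (ContinuousMap.evalCLM ℂ k) hci'.out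
    simp only [circleIntegral]
    exact this.symm
  have hdiff : DiffContOnCl ℂ (fun z : ℂ => G (x + z • v) k) (Metric.ball 0 R) := by
    refine DifferentiableOn.diffContOnCl ?_
    intro z hz
    have hz' := Metric.closure_ball_subset_closedBall hz
    exact ((h k).differentiableAt_line (hRU hz')).differentiableWithinAt
  have hC := hdiff.two_pi_i_inv_smul_circleIntegral_sub_inv_smul ht
  rw [ContinuousMap.smul_apply, hev, hC]

/-- A map that is jointly continuous and line-holomorphic in the first variable, as a map into
the space of continuous functions of the second variable. -/
lemma exists_curry_lineHolomorphicOn [CompleteSpace F] {K : Type*} [TopologicalSpace K]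
    [CompactSpace K] {G : E → K → F} {U : Set E} (hU : IsOpen U)
    (hG : ContinuousOn (Function.uncurry G) (U ×ˢ Set.univ))
    (h : ∀ k, LineHolomorphicOn (fun x => G x k) U) :
    ∃ G' : E → C(K, F), LineHolomorphicOn G' U ∧ ∀ x ∈ U, ∀ k, G' x k = G x k := by
  classical
  have hc : ∀ x ∈ U, Continuous (G x) := fun x hx =>
    hG.comp_continuous (f := fun k => (x, k)) (by fun_prop) (fun k => ⟨hx, Set.mem_univ _⟩)
  let G' : E → C(K, F) := fun x => if hx : x ∈ U then ⟨G x, hc x hx⟩ else 0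
  have hG' : ∀ x ∈ U, ∀ k, G' x k = G x k := fun x hx k => by simp [G', hx]
  refine ⟨G', lineHolomorphicOn_of_eval hU ?_ fun k => ⟨?_, fun x hx v => ?_⟩, hG'⟩
  · rw [continuousOn_iff_continuous_domRestrict]
    refine ContinuousMap.continuous_of_continuous_uncurry _ ?_
    have : (Function.uncurry fun (x : U) (k : K) => U.domRestrict G' x k)
        = fun q : U × K => Function.uncurry G (q.1.1, q.2) := by
      funext q
      exact hG' _ q.1.2 _
    rw [this]
    exact hG.comp_continuous (by fun_prop) fun q => ⟨q.1.2, Set.mem_univ _⟩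
  · exact (h k).1.congr fun x hx => hG' x hx k
  · refine ((h k).2 x hx v).congr_of_eventuallyEq ?_
    have hline : Continuous fun t : ℂ => x + t • v := by fun_prop
    filter_upwards [(hU.preimage hline).mem_nhds (by simpa using hx)] with t ht
    exact hG' _ ht k

/-- The bilinear map `(k, φ) ↦ ∫_a^b k φ` on continuous functions on `[a, b]`. -/
noncomputable def integralMulCLM (F : Type*) [NormedAddCommGroup F] [NormedSpace ℂ F] {a b : ℝ}
    (hab : a ≤ b) : C(Set.Icc a b, ℂ) →L[ℂ] C(Set.Icc a b, F) →L[ℂ] F :=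
  have hint : ∀ (k : C(Set.Icc a b, ℂ)) (φ : C(Set.Icc a b, F)), IntervalIntegrable
      (fun t => k (Set.projIcc a b hab t) • φ (Set.projIcc a b hab t)) MeasureTheory.volume a b :=
    fun k φ => Continuous.intervalIntegrable
      ((k.continuous.comp continuous_projIcc).smul (φ.continuous.comp continuous_projIcc)) _ _
  LinearMap.mkContinuous₂ (LinearMap.mk₂ ℂ
    (fun k φ => ∫ t in a..b, k (Set.projIcc a b hab t) • φ (Set.projIcc a b hab t))
    (fun k k' φ => by
      rw [← intervalIntegral.integral_add (hint k φ) (hint k' φ)]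
      simp [add_smul])
    (fun c k φ => by
      rw [← intervalIntegral.integral_smul]
      simp [mul_smul])
    (fun k φ φ' => by
      rw [← intervalIntegral.integral_add (hint k φ) (hint k φ')]
      simp [smul_add])
    (fun c k φ => by
      rw [← intervalIntegral.integral_smul]
      simp [smul_comm c])) |b - a| (fun k φ => by
    refine (intervalIntegral.norm_integral_le_of_norm_le_const (C := ‖k‖ * ‖φ‖) ?_).trans_eq
      (by ring)
    intro t _
    rw [norm_smul]
    exact mul_le_mul (k.norm_coe_le_norm _) (φ.norm_coe_le_norm _) (norm_nonneg _) (norm_nonneg _))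

lemma integralMulCLM_apply {a b : ℝ} (hab : a ≤ b) (k : C(Set.Icc a b, ℂ))
    (φ : C(Set.Icc a b, F)) : integralMulCLM F hab k φ
      = ∫ t in a..b, k (Set.projIcc a b hab t) • φ (Set.projIcc a b hab t) := rfl

/-- Osgood's lemma passes from `E` to `ℂ × E`: by the Cauchy formula in the first variable, `f` is
a continuous bilinear function of the Cauchy kernel, analytic in the first variable, and of the
restriction of `f` to a circle, analytic in the second variable as a map into a Banach space. -/
lemma LineHolomorphicOn.analyticOnNhd_prod {F : Type v} [NormedAddCommGroup F] [NormedSpace ℂ F]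
    [CompleteSpace F]
    (hE : ∀ (F : Type v) [NormedAddCommGroup F] [NormedSpace ℂ F] [CompleteSpace F]
      (f : E → F) (U : Set E), IsOpen U → LineHolomorphicOn f U → AnalyticOnNhd ℂ f U)
    {f : ℂ × E → F} {U : Set (ℂ × E)} (hU : IsOpen U) (hf : LineHolomorphicOn f U) :
    AnalyticOnNhd ℂ f U := by
  rintro ⟨z₀, w₀⟩ hp
  obtain ⟨R₀, hR₀, hRU₀⟩ := Metric.isOpen_iff.1 hU _ hp
  obtain ⟨R, hR, hRR⟩ := exists_between hR₀
  have hRU : ∀ z ∈ Metric.closedBall z₀ R, ∀ w ∈ Metric.ball w₀ R, (z, w) ∈ U := by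
    intro z hz w hw
    apply hRU₀
    rw [← ball_prod_same]
    exact ⟨Metric.closedBall_subset_ball hRR hz, Metric.ball_subset_ball hRR.le hw⟩
  have hpi : (0 : ℝ) ≤ 2 * Real.pi := by positivity
  have hcm : ∀ θ : ℝ, circleMap z₀ R θ ∈ Metric.closedBall z₀ R := fun θ =>
    circleMap_mem_closedBall _ hR.le _
  obtain ⟨G, hG, hGe⟩ := exists_curry_lineHolomorphicOn (K := Set.Icc 0 (2 * Real.pi))
    (G := fun w θ => f (circleMap z₀ R θ, w)) (Metric.isOpen_ball (x := w₀) (ε := R))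
    (by
      refine hf.1.comp (f := fun q : E × Set.Icc 0 (2 * Real.pi) => (circleMap z₀ R q.2, q.1))
        (by fun_prop) ?_
      exact fun q hq => hRU _ (hcm _) _ hq.1)
    (fun θ => by
      refine ⟨hf.1.comp (f := fun q : E => (circleMap z₀ R θ, q)) (by fun_prop)
        (fun q hq => hRU _ (hcm _) _ hq), fun x hx v => ?_⟩
      simpa using hf.2 (circleMap z₀ R θ, x) (hRU _ (hcm _) _ hx) (0, v))
  have hne : ∀ z ∈ Metric.ball z₀ R, ∀ θ : ℝ, circleMap z₀ R θ - z ≠ 0 := by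
    intro z hz θ h0
    rw [← sub_eq_zero.1 h0] at hz
    have := circleMap_mem_sphere z₀ hR.le θ
    simp only [Metric.mem_ball, Metric.mem_sphere] at this hz
    exact hz.ne this
  obtain ⟨k, hk, hke⟩ := exists_curry_lineHolomorphicOn (E := ℂ) (F := ℂ)
    (K := Set.Icc 0 (2 * Real.pi))
    (G := fun z θ => deriv (circleMap z₀ R) θ * (circleMap z₀ R θ - z)⁻¹)
    (Metric.isOpen_ball (x := z₀) (ε := R))
    (by
      simp only [deriv_circleMap, Function.uncurry_def]
      refine ContinuousOn.mul (by fun_prop) (ContinuousOn.inv₀ (by fun_prop) ?_)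
      exact fun q hq => hne _ hq.1 _)
    (fun θ => by
      refine DifferentiableOn.lineHolomorphicOn Metric.isOpen_ball ?_
      refine DifferentiableOn.mul (by fun_prop) (DifferentiableOn.inv (by fun_prop) ?_)
      exact fun q hq => hne _ hq _)
  have hGa : AnalyticAt ℂ G w₀ := hE _ G _ Metric.isOpen_ball hG w₀ (Metric.mem_ball_self hR)
  have hka : AnalyticAt ℂ k z₀ := by
    refine DifferentiableOn.analyticAt (s := Metric.ball z₀ R) ?_ (Metric.ball_mem_nhds _ hR)
    intro z hz
    have := hk.differentiableAt_line (x := 0) (v := 1) (t := z) (by simpa using hz)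
    simpa using this.differentiableWithinAt
  have hana : AnalyticAt ℂ (fun q : ℂ × E =>
      (2 * Real.pi * Complex.I : ℂ)⁻¹ • integralMulCLM F hpi (k q.1) (G q.2)) (z₀, w₀) := by
    have hk1 : AnalyticAt ℂ (fun q : ℂ × E => k q.1) (z₀, w₀) :=
      AnalyticAt.fun_comp (g := k) (f := Prod.fst) hka analyticAt_fst
    have hG1 : AnalyticAt ℂ (fun q : ℂ × E => G q.2) (z₀, w₀) :=
      AnalyticAt.fun_comp (g := G) (f := Prod.snd) hGa analyticAt_snd
    have hb : AnalyticAt ℂ (fun q : ℂ × E => integralMulCLM F hpi (k q.1) (G q.2)) (z₀, w₀) :=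
      ((integralMulCLM F hpi).analyticAt_bilinear (k z₀, G w₀)).comp₂ hk1 hG1
    exact analyticAt_const.smul hb
  refine hana.congr ?_
  filter_upwards [prod_mem_nhds (Metric.ball_mem_nhds z₀ hR) (Metric.ball_mem_nhds w₀ hR)]
    with q hq
  have hdiff : DiffContOnCl ℂ (fun z : ℂ => f (z, q.2)) (Metric.ball z₀ R) := by
    refine DifferentiableOn.diffContOnCl ?_
    intro z hz
    have hz' := Metric.closure_ball_subset_closedBall hz
    have := hf.differentiableAt_line (x := (0, q.2)) (v := (1, 0)) (t := z)
      (by simpa using hRU z hz' _ hq.2)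
    simpa using this.differentiableWithinAt
  rw [← show (2 * Real.pi * Complex.I : ℂ)⁻¹ • _ = f q from
    hdiff.two_pi_i_inv_smul_circleIntegral_sub_inv_smul hq.1]
  congr 1
  rw [integralMulCLM_apply, circleIntegral]
  refine intervalIntegral.integral_congr fun θ hθ => ?_
  rw [Set.uIcc_of_le hpi] at hθ
  simp only [Set.projIcc_of_mem hpi hθ, hke _ hq.1, hGe _ hq.2, mul_smul]

lemma LineHolomorphicOn.comp_continuousLinearEquiv {E' : Type*} [NormedAddCommGroup E']
    [NormedSpace ℂ E'] (e : E' ≃L[ℂ] E) {f : E → F} {U : Set E} (hf : LineHolomorphicOn f U) :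
    LineHolomorphicOn (f ∘ e) (e ⁻¹' U) := by
  refine ⟨hf.1.comp e.continuous.continuousOn fun x hx => hx, fun x hx v => ?_⟩
  simpa [Function.comp_def] using hf.2 (e x) hx (e v)

lemma ContinuousLinearEquiv.analyticOnNhd_of_comp {E' : Type*} [NormedAddCommGroup E']
    [NormedSpace ℂ E'] (e : E' ≃L[ℂ] E) {f : E → F} {U : Set E}
    (hf : AnalyticOnNhd ℂ (f ∘ e) (e ⁻¹' U)) : AnalyticOnNhd ℂ f U := by
  intro x hx
  have h1 : AnalyticAt ℂ (f ∘ e) (e.symm x) := hf _ (by simpa using hx)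
  have h2 := AnalyticAt.fun_comp (g := f ∘ e) (f := e.symm) h1
    (e.symm.toContinuousLinearMap.analyticAt x)
  simpa [Function.comp_def] using h2

/-- **Osgood's lemma**: on an open subset of a finite-dimensional space, a continuous function that
is holomorphic along complex lines is analytic. -/
theorem LineHolomorphicOn.analyticOnNhd {F : Type v} [NormedAddCommGroup F]
    [NormedSpace ℂ F] [FiniteDimensional ℂ E] [CompleteSpace F]
    {f : E → F} {U : Set E} (hU : IsOpen U) (hf : LineHolomorphicOn f U) :
    AnalyticOnNhd ℂ f U := by
  have key : ∀ d : ℕ, ∀ (F : Type v) [NormedAddCommGroup F] [NormedSpace ℂ F] [CompleteSpace F]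
      (f : (Fin d → ℂ) → F) (U : Set (Fin d → ℂ)), IsOpen U → LineHolomorphicOn f U →
      AnalyticOnNhd ℂ f U := by
    intro d
    induction d with
    | zero =>
      intro F _ _ _ f U _ _ x _
      have : f = fun _ => f x := by
        funext y
        rw [Subsingleton.elim y x]
      rw [this]
      exact analyticAt_const
    | succ d ih =>
      intro F _ _ _ f U hU hf
      have e : (ℂ × (Fin d → ℂ)) ≃L[ℂ] (Fin (d + 1) → ℂ) :=
        ContinuousLinearEquiv.ofFinrankEq (by simp [add_comm])
      exact e.analyticOnNhd_of_comp (LineHolomorphicOn.analyticOnNhd_prod ih (hU.preimage e.continuous)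
        (hf.comp_continuousLinearEquiv e))
  have e : (Fin (Module.finrank ℂ E) → ℂ) ≃L[ℂ] E := ContinuousLinearEquiv.ofFinrankEq (by simp)
  exact e.analyticOnNhd_of_comp (key _ _ _ _ (hU.preimage e.continuous) (hf.comp_continuousLinearEquiv e))

lemma DifferentiableOn.analyticOnNhd_of_finiteDimensional [FiniteDimensional ℂ E]
    [CompleteSpace F] {f : E → F} {U : Set E} (hU : IsOpen U) (hf : DifferentiableOn ℂ f U) :
    AnalyticOnNhd ℂ f U :=
  (hf.lineHolomorphicOn hU).analyticOnNhd hU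

/-- A uniform limit of holomorphic functions of several variables is analytic. -/
lemma TendstoUniformlyOn.analyticOnNhd_of_finiteDimensional [FiniteDimensional ℂ E]
    [CompleteSpace F] {f : ℕ → E → F} {g : E → F} {U : Set E} (hU : IsOpen U)
    (h : TendstoUniformlyOn f g Filter.atTop U) (hf : ∀ n, DifferentiableOn ℂ (f n) U) :
    AnalyticOnNhd ℂ g U := by
  refine LineHolomorphicOn.analyticOnNhd hU ⟨h.continuousOn
    (Filter.Frequently.of_forall fun n => (hf n).continuousOn), fun x hx v => ?_⟩
  have hline : Continuous fun t : ℂ => x + t • v := by fun_prop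
  have hO : IsOpen ((fun t : ℂ => x + t • v) ⁻¹' U) := hU.preimage hline
  have h1 := (h.comp (fun t : ℂ => x + t • v)).tendstoLocallyUniformlyOn.differentiableOn
    (Filter.Eventually.of_forall fun n => (hf n).comp (by fun_prop) fun t ht => ht) hO
  exact h1.differentiableAt (hO.mem_nhds (by simpa using hx))

/-- A family of holomorphic functions depending continuously on a parameter in a compact space, as
an analytic map into the space of continuous functions of the parameter; its derivative
is the parameter-wise derivative. -/
lemma exists_curry_analyticOnNhd [FiniteDimensional ℂ E] [CompleteSpace F] {K : Type*}
    [TopologicalSpace K] [CompactSpace K] {G : E → K → F} {U : Set E} (hU : IsOpen U)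
    (hG : ContinuousOn (Function.uncurry G) (U ×ˢ Set.univ))
    (h : ∀ k, DifferentiableOn ℂ (fun x => G x k) U) :
    ∃ G' : E → C(K, F), AnalyticOnNhd ℂ G' U ∧ (∀ x ∈ U, ∀ k, G' x k = G x k) ∧
      ∀ x ∈ U, ∀ v k, fderiv ℂ G' x v k = fderiv ℂ (fun y => G y k) x v := by
  obtain ⟨G', h1, h2⟩ := exists_curry_lineHolomorphicOn hU hG
    fun k => (h k).lineHolomorphicOn hU
  have h3 := h1.analyticOnNhd hU
  refine ⟨G', h3, h2, fun x hx v k => ?_⟩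
  have h4 : HasFDerivAt (fun y => G' y k)
      ((ContinuousMap.evalCLM ℂ k).comp (fderiv ℂ G' x)) x :=
    (ContinuousMap.evalCLM ℂ k : C(K, F) →L[ℂ] F).hasFDerivAt.comp x
      (h3 x hx).differentiableAt.hasFDerivAt
  have h5 : (fun y => G y k) =ᶠ[nhds x] fun y => G' y k := by
    filter_upwards [hU.mem_nhds hx] with y hy using (h2 y hy k).symm
  rw [h5.fderiv_eq, h4.fderiv]
  rfl

/-- Differentiation of an integral whose integrand depends holomorphically on a parameter. -/
lemma hasFDerivAt_intervalIntegral_of_holomorphic [FiniteDimensional ℂ E] [CompleteSpace F]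
    {a b : ℝ} (hab : a ≤ b) {G : ℝ → E → F} {U : Set E} (hU : IsOpen U)
    (hG : ContinuousOn (Function.uncurry G) (Set.Icc a b ×ˢ U))
    (h : ∀ t ∈ Set.Icc a b, DifferentiableOn ℂ (G t) U) :
    AnalyticOnNhd ℂ (fun x => ∫ t in a..b, G t x) U ∧
    ∀ x ∈ U, ∀ v, ContinuousOn (fun t => fderiv ℂ (G t) x v) (Set.Icc a b) ∧
      fderiv ℂ (fun x => ∫ t in a..b, G t x) x v = ∫ t in a..b, fderiv ℂ (G t) x v := by
  obtain ⟨G', h1, h2, h3⟩ := exists_curry_analyticOnNhd (K := Set.Icc a b)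
    (G := fun x t => G t x) hU
    (hG.comp (f := fun q : E × Set.Icc a b => (q.2.1, q.1)) (by fun_prop)
      fun q hq => ⟨q.2.2, hq.1⟩)
    fun k => h k k.2
  have hint : ∀ x ∈ U, (∫ t in a..b, G t x) = integralMulCLM F hab 1 (G' x) := by
    intro x hx
    rw [integralMulCLM_apply]
    refine intervalIntegral.integral_congr fun t ht => ?_
    rw [Set.uIcc_of_le hab] at ht
    simp [Set.projIcc_of_mem hab ht, h2 x hx]
  have hev : ∀ x ∈ U, (fun x => ∫ t in a..b, G t x) =ᶠ[nhds x]
      fun y => integralMulCLM F hab 1 (G' y) := by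
    intro x hx
    filter_upwards [hU.mem_nhds hx] with y hy using hint y hy
  refine ⟨fun x hx => ?_, fun x hx v => ⟨?_, ?_⟩⟩
  · exact (((integralMulCLM F hab 1).analyticAt _).comp (h1 x hx)).congr (hev x hx).symm
  · rw [continuousOn_iff_continuous_domRestrict]
    convert (fderiv ℂ G' x v).continuous using 1
    funext k
    exact (h3 x hx v k).symm
  · rw [(hev x hx).fderiv_eq]
    have : HasFDerivAt (fun y => integralMulCLM F hab 1 (G' y))
        ((integralMulCLM F hab 1).comp (fderiv ℂ G' x)) x :=
      (integralMulCLM F hab 1).hasFDerivAt.comp x (h1 x hx).differentiableAt.hasFDerivAt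
    rw [this.fderiv, ContinuousLinearMap.comp_apply, integralMulCLM_apply]
    refine intervalIntegral.integral_congr fun t ht => ?_
    rw [Set.uIcc_of_le hab] at ht
    simp [Set.projIcc_of_mem hab ht, h3 x hx]

end Osgood

/-! ### Cauchy estimates -/

section CauchyEstimates

variable {E : Type*} [NormedAddCommGroup E] [NormedSpace ℂ E]
  {F : Type*} [NormedAddCommGroup F] [NormedSpace ℂ F]

/-- Cauchy estimate along a holomorphic disc `c` of radius `R` in the domain. -/
lemma norm_fderiv_deriv_le {f : E → F} {U : Set E} (hU : IsOpen U) (hf : DifferentiableOn ℂ f U)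
    {C : ℝ} (hC : ∀ x ∈ U, ‖f x‖ ≤ C) {c : ℂ → E} {R : ℝ} (hR : 0 < R) (hc : Differentiable ℂ c)
    (hcU : ∀ t : ℂ, ‖t‖ < R → c t ∈ U) : ‖fderiv ℂ f (c 0) (deriv c 0)‖ ≤ C / R := by
  have h0 : c 0 ∈ U := hcU 0 (by simpa using hR)
  have hC0 : 0 ≤ C := (norm_nonneg _).trans (hC _ h0)
  have hder : deriv (fun t => f (c t)) 0 = fderiv ℂ f (c 0) (deriv c 0) :=
    (((hf.differentiableAt (hU.mem_nhds h0)).hasFDerivAt).comp_hasDerivAt (0 : ℂ)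
      (hc 0).hasDerivAt).deriv
  rw [← hder, le_div_iff₀ hR]
  -- The disc `‖t‖ < R` is open, so the one-variable estimate is applied on the smaller circles of
  -- radius `a / D`, with `a` increasing to `D R`.
  refine le_of_forall_lt_imp_le_of_dense fun a ha => ?_
  rcases eq_or_lt_of_le (norm_nonneg (deriv (fun t => f (c t)) 0)) with hz | hz
  · rw [← hz, zero_mul] at ha
    exact ha.le.trans hC0
  · set D := ‖deriv (fun t => f (c t)) 0‖
    by_cases ha0 : a ≤ 0
    · exact ha0.trans hC0
    push Not at ha0
    have hR' : 0 < a / D := div_pos ha0 hz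
    have hlt : a / D < R := by rwa [div_lt_iff₀ hz, mul_comm]
    have hin : ∀ t ∈ Metric.closedBall (0 : ℂ) (a / D), c t ∈ U := fun t ht =>
      hcU t ((by simpa using ht : ‖t‖ ≤ a / D).trans_lt hlt)
    have h1 : DiffContOnCl ℂ (fun t => f (c t)) (Metric.ball 0 (a / D)) := by
      refine DifferentiableOn.diffContOnCl fun t ht => ?_
      have := hin t (Metric.closure_ball_subset_closedBall ht)
      exact ((hf.differentiableAt (hU.mem_nhds this)).comp t (hc t)).differentiableWithinAt
    have h2 := Complex.norm_deriv_le_of_forall_mem_sphere_norm_le hR' h1 (C := C)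
      fun t ht => hC _ (hin t (Metric.sphere_subset_closedBall ht))
    change D ≤ C / (a / D) at h2
    rw [le_div_iff₀ hR'] at h2
    field_simp at h2
    linarith

lemma norm_fderiv_apply_le_div {f : E → F} {U : Set E} (hU : IsOpen U)
    (hf : DifferentiableOn ℂ f U) {C : ℝ} (hC : ∀ x ∈ U, ‖f x‖ ≤ C) {x v : E} {R : ℝ} (hR : 0 < R)
    (hx : ∀ t : ℂ, ‖t‖ < R → x + t • v ∈ U) : ‖fderiv ℂ f x v‖ ≤ C / R := by
  have hd : HasDerivAt (fun t : ℂ => x + t • v) v 0 := by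
    simpa using ((hasDerivAt_id (0 : ℂ)).smul_const v).const_add x
  have := norm_fderiv_deriv_le hU hf hC hR (c := fun t : ℂ => x + t • v) (by fun_prop) hx
  rw [hd.deriv] at this
  simpa using this

/-- Cauchy estimate in the direction `v`, when the disc of radius `r` about `x` in the complex line
spanned by `v` lies in the domain. -/
lemma norm_fderiv_apply_le_mul {f : E → F} {U : Set E} (hU : IsOpen U)
    (hf : DifferentiableOn ℂ f U) {C : ℝ} (hC : ∀ x ∈ U, ‖f x‖ ≤ C) {x v : E} {r : ℝ} (hr : 0 < r)
    (hx : ∀ t : ℂ, ‖t • v‖ < r → x + t • v ∈ U) : ‖fderiv ℂ f x v‖ ≤ C / r * ‖v‖ := by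
  rcases eq_or_ne v 0 with rfl | hv
  · simp
  · have hv' : 0 < ‖v‖ := norm_pos_iff.2 hv
    refine (norm_fderiv_apply_le_div hU hf hC (div_pos hr hv') fun t ht => hx t ?_).trans_eq ?_
    · rwa [norm_smul, ← lt_div_iff₀ hv']
    · field_simp

lemma norm_fderiv_le_div {f : E → F} {U : Set E} (hU : IsOpen U)
    (hf : DifferentiableOn ℂ f U) {C : ℝ} (hC : ∀ x ∈ U, ‖f x‖ ≤ C) {x : E} {r : ℝ} (hr : 0 < r)
    (hx : Metric.ball x r ⊆ U) : ‖fderiv ℂ f x‖ ≤ C / r := by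
  have hC0 : 0 ≤ C := (norm_nonneg _).trans (hC _ (hx (Metric.mem_ball_self hr)))
  refine ContinuousLinearMap.opNorm_le_bound _ (by positivity) fun v =>
    norm_fderiv_apply_le_mul hU hf hC hr fun t ht => hx ?_
  simpa using ht

end CauchyEstimates

/-! ### Flows of holomorphic vector fields -/

section Flow

variable {E : Type*} [NormedAddCommGroup E] [NormedSpace ℂ E]

/-- `X` is a holomorphic vector field on `U`, bounded by `M`, and `W` is an open set of initial
points at distance at least `ρ > 4 M` from the complement of `U`. The factor `4` makes `X` Lipschitz
with constant `M / (ρ - 3 M) < 1` on the balls of radius `3 M` about points of `W`; these balls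
contain every solution whose time-one value coincides with that of a solution starting at the
centre. -/
structure IsSlowField (X : E → E) (U W : Set E) (M ρ : ℝ) : Prop where
  isOpen_domain : IsOpen U
  isOpen_start : IsOpen W
  differentiableOn : DifferentiableOn ℂ X U
  norm_le : ∀ x ∈ U, ‖X x‖ ≤ M
  ball_subset : ∀ p ∈ W, Metric.ball p ρ ⊆ U
  nonneg : 0 ≤ M
  four_mul_lt : 4 * M < ρ

/-- `Φ t` is the time-`t` flow of `X` for `t ∈ [0, 1]`, on the set `W` of initial points. The flow
equation is stated in integral form, and `M` bounds the displacement. -/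
structure IsFlow (X : E → E) (Φ : ℝ → E → E) (W : Set E) (M : ℝ) : Prop where
  continuousOn : ContinuousOn (Function.uncurry Φ) (Set.Icc 0 1 ×ˢ W)
  analyticOnNhd : ∀ t ∈ Set.Icc (0 : ℝ) 1, AnalyticOnNhd ℂ (Φ t) W
  norm_sub_le : ∀ t ∈ Set.Icc (0 : ℝ) 1, ∀ p ∈ W, ‖Φ t p - p‖ ≤ M
  eq_integral : ∀ t ∈ Set.Icc (0 : ℝ) 1, ∀ p ∈ W, Φ t p = p + ∫ s in (0 : ℝ)..t, X (Φ s p)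

/-- The Picard iterates of the flow of `X`. -/
noncomputable def picardIterate (X : E → E) : ℕ → ℝ → E → E
  | 0 => fun _ p => p
  | n + 1 => fun t p => p + ∫ s in (0 : ℝ)..t, X (picardIterate X n s p)

namespace IsSlowField

variable {X : E → E} {U W : Set E} {M ρ : ℝ}

lemma sub_pos (h : IsSlowField X U W M ρ) : 0 < ρ - 3 * M := by
  linarith [h.nonneg, h.four_mul_lt]

lemma closedBall_subset (h : IsSlowField X U W M ρ) {p : E} (hp : p ∈ W) :
    Metric.closedBall p (3 * M) ⊆ U :=
  (Metric.closedBall_subset_ball (by linarith [h.nonneg, h.four_mul_lt])).trans (h.ball_subset p hp)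

lemma mem_of_norm_sub_le (h : IsSlowField X U W M ρ) {p x : E} (hp : p ∈ W)
    (hx : ‖x - p‖ ≤ M) : x ∈ U :=
  h.closedBall_subset hp (by
    rw [mem_closedBall_iff_norm]
    linarith [h.nonneg])

lemma const_nonneg (h : IsSlowField X U W M ρ) : 0 ≤ M / (ρ - 3 * M) :=
  div_nonneg h.nonneg h.sub_pos.le

lemma const_lt_one (h : IsSlowField X U W M ρ) : M / (ρ - 3 * M) < 1 := by
  rw [div_lt_one h.sub_pos]
  linarith [h.four_mul_lt]

lemma norm_sub_le (h : IsSlowField X U W M ρ) {p x y : E} (hp : p ∈ W)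
    (hx : ‖x - p‖ ≤ 3 * M) (hy : ‖y - p‖ ≤ 3 * M) :
    ‖X x - X y‖ ≤ M / (ρ - 3 * M) * ‖x - y‖ := by
  refine (convex_closedBall p (3 * M)).norm_image_sub_le_of_norm_fderiv_le (𝕜 := ℂ)
    (fun z hz => h.differentiableOn.differentiableAt
      (h.isOpen_domain.mem_nhds (h.closedBall_subset hp hz)))
    (fun z hz => norm_fderiv_le_div h.isOpen_domain h.differentiableOn h.norm_le h.sub_pos ?_)
    (mem_closedBall_iff_norm.2 hy) (mem_closedBall_iff_norm.2 hx)
  refine (Metric.ball_subset_ball' ?_).trans (h.ball_subset p hp)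
  have := Metric.mem_closedBall.1 hz
  linarith

end IsSlowField

/-- Joint continuity of a primitive in its endpoint and a parameter, relative to a subset. -/
lemma continuousOn_primitive_parametric {F : Type*} [NormedAddCommGroup F] [NormedSpace ℝ F]
    {P : Type*} [TopologicalSpace P]
    {u : ℝ → P → F} {W : Set P}
    (hu : ContinuousOn (Function.uncurry u) (Set.Icc 0 1 ×ˢ W)) :
    ContinuousOn (fun q : ℝ × P => ∫ s in (0 : ℝ)..q.1, u s q.2) (Set.Icc 0 1 ×ˢ W) := by
  have h01 : (0 : ℝ) ≤ 1 := zero_le_one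
  let v : W → ℝ → F := fun p s => u (Set.projIcc 0 1 h01 s) p
  have hv : Continuous (Function.uncurry v) :=
    hu.comp_continuous (f := fun q : W × ℝ => ((Set.projIcc 0 1 h01 q.2 : ℝ), (q.1 : P)))
      (by fun_prop) fun q => ⟨(Set.projIcc 0 1 h01 q.2).2, q.1.2⟩
  have hc := intervalIntegral.continuous_parametric_primitive_of_continuous (a₀ := 0)
    (μ := MeasureTheory.volume) hv
  rw [continuousOn_iff_continuous_domRestrict]
  have := hc.comp (f := fun q : (Set.Icc (0 : ℝ) 1 ×ˢ W : Set (ℝ × P)) =>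
    ((⟨q.1.2, q.2.2⟩ : W), q.1.1)) (by fun_prop)
  convert this using 1
  funext q
  refine intervalIntegral.integral_congr fun s hs => ?_
  rw [Set.uIcc_of_le q.2.1.1] at hs
  simp [Set.projIcc_of_mem h01 ⟨hs.1, hs.2.trans q.2.1.2⟩]

lemma continuousOn_slice {P F : Type*} [TopologicalSpace P] [TopologicalSpace F] {W : Set P}
    {Φ : ℝ → P → F}
    (h : ContinuousOn (Function.uncurry Φ) (Set.Icc 0 1 ×ˢ W))
    {p : P} (hp : p ∈ W) : ContinuousOn (fun s => Φ s p) (Set.Icc 0 1) :=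
  h.comp (f := fun s : ℝ => (s, p)) (by fun_prop) fun s hs => ⟨hs, hp⟩

section Estimates

variable {X : E → E} {U W : Set E} {M ρ : ℝ} {Φ : ℝ → E → E}

/-- A contraction estimate for the Picard operator, on curves that stay near their start. -/
lemma IsSlowField.norm_integral_sub_le (h : IsSlowField X U W M ρ) {u w : ℝ → E} {p : E}
    (hp : p ∈ W) (hu : ContinuousOn u (Set.Icc 0 1)) (hw : ContinuousOn w (Set.Icc 0 1))
    (hup : ∀ s ∈ Set.Icc (0 : ℝ) 1, ‖u s - p‖ ≤ M) (hwp : ∀ s ∈ Set.Icc (0 : ℝ) 1, ‖w s - p‖ ≤ M)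
    {C : ℝ} (hC0 : 0 ≤ C) (hC : ∀ s ∈ Set.Icc (0 : ℝ) 1, ‖u s - w s‖ ≤ C) {t : ℝ}
    (ht : t ∈ Set.Icc (0 : ℝ) 1) :
    ‖(∫ s in (0 : ℝ)..t, X (u s)) - ∫ s in (0 : ℝ)..t, X (w s)‖ ≤ M / (ρ - 3 * M) * C := by
  have hsub : Set.uIcc (0 : ℝ) t ⊆ Set.Icc 0 1 := by
    rw [Set.uIcc_of_le ht.1]
    exact Set.Icc_subset_Icc_right ht.2
  have hint : ∀ u : ℝ → E, ContinuousOn u (Set.Icc 0 1) →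
      (∀ s ∈ Set.Icc (0 : ℝ) 1, ‖u s - p‖ ≤ M) →
      IntervalIntegrable (fun s => X (u s)) MeasureTheory.volume 0 t := fun u hu hup =>
    ((h.differentiableOn.continuousOn.comp hu fun s hs =>
      h.mem_of_norm_sub_le hp (hup s hs)).mono hsub).intervalIntegrable
  rw [← intervalIntegral.integral_sub (hint u hu hup) (hint w hw hwp)]
  have hK := h.const_nonneg
  have hM := h.nonneg
  have : ‖∫ s in (0 : ℝ)..t, (X (u s) - X (w s))‖ ≤ M / (ρ - 3 * M) * C * |t - 0| := by
    refine intervalIntegral.norm_integral_le_of_norm_le_const fun s hs => ?_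
    have hs' := hsub (Set.uIoc_subset_uIcc hs)
    refine (h.norm_sub_le hp ((hup s hs').trans (by linarith))
      ((hwp s hs').trans (by linarith))).trans ?_
    gcongr
    exact hC s hs'
  rw [sub_zero, abs_of_nonneg ht.1] at this
  have h0 : 0 ≤ M / (ρ - 3 * M) * C := by positivity
  nlinarith [ht.2]

namespace IsFlow

lemma apply_zero (hΦ : IsFlow X Φ W M) {p : E} (hp : p ∈ W) : Φ 0 p = p := by
  simpa using hΦ.eq_integral 0 (by simp) p hp

lemma continuousOn_field (h : IsSlowField X U W M ρ) (hΦ : IsFlow X Φ W M) :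
    ContinuousOn (Function.uncurry fun s p => X (Φ s p)) (Set.Icc 0 1 ×ˢ W) :=
  h.differentiableOn.continuousOn.comp hΦ.continuousOn fun q hq =>
    h.mem_of_norm_sub_le hq.2 (hΦ.norm_sub_le q.1 hq.1 q.2 hq.2)

lemma mem_domain (h : IsSlowField X U W M ρ) (hΦ : IsFlow X Φ W M) {t : ℝ}
    (ht : t ∈ Set.Icc (0 : ℝ) 1) {p : E} (hp : p ∈ W) : Φ t p ∈ U :=
  h.mem_of_norm_sub_le hp (hΦ.norm_sub_le t ht p hp)

end IsFlow

end Estimates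

section FiniteDimensional

variable [FiniteDimensional ℂ E] {X : E → E} {U W : Set E} {M ρ : ℝ}

lemma IsSlowField.picardIterate_spec (h : IsSlowField X U W M ρ) (n : ℕ) :
    ContinuousOn (Function.uncurry (picardIterate X n)) (Set.Icc 0 1 ×ˢ W) ∧
    (∀ t ∈ Set.Icc (0 : ℝ) 1, DifferentiableOn ℂ (picardIterate X n t) W) ∧
    ∀ t ∈ Set.Icc (0 : ℝ) 1, ∀ p ∈ W, ‖picardIterate X n t p - p‖ ≤ M := by
  have : CompleteSpace E := FiniteDimensional.complete ℂ E
  induction n with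
  | zero =>
    refine ⟨continuous_snd.continuousOn, fun t _ => differentiableOn_id, fun t _ p _ => ?_⟩
    simpa [picardIterate] using h.nonneg
  | succ n ih =>
    obtain ⟨h1, h2, h3⟩ := ih
    have hmem : ∀ s ∈ Set.Icc (0 : ℝ) 1, ∀ p ∈ W, picardIterate X n s p ∈ U :=
      fun s hs p hp => h.mem_of_norm_sub_le hp (h3 s hs p hp)
    have hu : ContinuousOn (Function.uncurry fun s p => X (picardIterate X n s p))
        (Set.Icc 0 1 ×ˢ W) :=
      h.differentiableOn.continuousOn.comp h1 fun q hq => hmem q.1 hq.1 q.2 hq.2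
    refine ⟨?_, fun t ht => ?_, fun t ht p hp => ?_⟩
    · exact continuous_snd.continuousOn.add (continuousOn_primitive_parametric hu)
    · refine differentiableOn_id.add ?_
      have hsub : Set.Icc (0 : ℝ) t ⊆ Set.Icc 0 1 := Set.Icc_subset_Icc_right ht.2
      exact (hasFDerivAt_intervalIntegral_of_holomorphic ht.1 h.isOpen_start
        (hu.mono (Set.prod_mono hsub subset_rfl)) fun s hs =>
          h.differentiableOn.comp (h2 s (hsub hs)) fun p hp =>
            hmem s (hsub hs) p hp).1.differentiableOn
    · have : ‖∫ s in (0 : ℝ)..t, X (picardIterate X n s p)‖ ≤ M * |t - 0| := by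
        refine intervalIntegral.norm_integral_le_of_norm_le_const fun s hs => ?_
        rw [Set.uIoc_of_le ht.1] at hs
        exact h.norm_le _ (hmem s ⟨hs.1.le, hs.2.trans ht.2⟩ p hp)
      rw [sub_zero, abs_of_nonneg ht.1] at this
      simp only [picardIterate, add_sub_cancel_left]
      nlinarith [h.nonneg, ht.2]

/-- A slow holomorphic field has a flow up to time one that is holomorphic in the initial point:
the Picard iterates are holomorphic and converge uniformly. A real-linear condition `L x = 0`
that is preserved by the field is preserved by the flow. -/
theorem IsSlowField.exists_flow (h : IsSlowField X U W M ρ) {G : Type*} [NormedAddCommGroup G]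
    [NormedSpace ℝ G] [CompleteSpace G] (L : E →L[ℝ] G) (hL : ∀ x ∈ U, L x = 0 → L (X x) = 0) :
    ∃ Φ : ℝ → E → E, IsFlow X Φ W M ∧
      ∀ t ∈ Set.Icc (0 : ℝ) 1, ∀ p ∈ W, L p = 0 → L (Φ t p) = 0 := by
  have : CompleteSpace E := FiniteDimensional.complete ℂ E
  set K := M / (ρ - 3 * M) with hKdef
  have hK0 : 0 ≤ K := h.const_nonneg
  have hK1 : K < 1 := h.const_lt_one
  have hM := h.nonneg
  have hstep : ∀ n, ∀ t ∈ Set.Icc (0 : ℝ) 1, ∀ p ∈ W,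
      ‖picardIterate X (n + 1) t p - picardIterate X n t p‖ ≤ M * K ^ n := by
    intro n
    induction n with
    | zero =>
      intro t ht p hp
      simpa [picardIterate] using (h.picardIterate_spec 1).2.2 t ht p hp
    | succ n ih =>
      intro t ht p hp
      have := h.norm_integral_sub_le hp
        (continuousOn_slice (h.picardIterate_spec (n + 1)).1 hp)
        (continuousOn_slice (h.picardIterate_spec n).1 hp)
        (fun s hs => (h.picardIterate_spec (n + 1)).2.2 s hs p hp)
        (fun s hs => (h.picardIterate_spec n).2.2 s hs p hp)
        (C := M * K ^ n) (by positivity) (fun s hs => ih s hs p hp) ht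
      have he : picardIterate X (n + 1 + 1) t p - picardIterate X (n + 1) t p
          = (∫ s in (0 : ℝ)..t, X (picardIterate X (n + 1) s p))
            - ∫ s in (0 : ℝ)..t, X (picardIterate X n s p) := by
        simp only [picardIterate]
        abel
      rw [he]
      refine this.trans_eq ?_
      rw [← hKdef]
      ring
  have hdist : ∀ t ∈ Set.Icc (0 : ℝ) 1, ∀ p ∈ W, ∀ n,
      dist (picardIterate X n t p) (picardIterate X (n + 1) t p) ≤ M * K ^ n := by
    intro t ht p hp n
    rw [dist_comm, dist_eq_norm]
    exact hstep n t ht p hp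
  have hex : ∀ t p, ∃ y, t ∈ Set.Icc (0 : ℝ) 1 → p ∈ W →
      Filter.Tendsto (fun n => picardIterate X n t p) Filter.atTop (nhds y) := by
    intro t p
    by_cases htp : t ∈ Set.Icc (0 : ℝ) 1 ∧ p ∈ W
    · obtain ⟨y, hy⟩ := cauchySeq_tendsto_of_complete
        (cauchySeq_of_le_geometric K M hK1 (hdist t htp.1 p htp.2))
      exact ⟨y, fun _ _ => hy⟩
    · exact ⟨p, fun h1 h2 => absurd ⟨h1, h2⟩ htp⟩
  choose Φ hΦ using hex
  have hlim : ∀ t ∈ Set.Icc (0 : ℝ) 1, ∀ p ∈ W,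
      Filter.Tendsto (fun n => picardIterate X n t p) Filter.atTop (nhds (Φ t p)) :=
    fun t ht p hp => hΦ t p ht hp
  have hest : ∀ n, ∀ t ∈ Set.Icc (0 : ℝ) 1, ∀ p ∈ W,
      dist (picardIterate X n t p) (Φ t p) ≤ M * K ^ n / (1 - K) := fun n t ht p hp =>
    dist_le_of_le_geometric_of_tendsto K M hK1 (hdist t ht p hp) (hlim t ht p hp) n
  have hzero : Filter.Tendsto (fun n => M * K ^ n / (1 - K)) Filter.atTop (nhds 0) := by
    simpa using ((tendsto_pow_atTop_nhds_zero_of_lt_one hK0 hK1).const_mul M).div_const (1 - K)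
  have hunif : TendstoUniformlyOn (fun n => Function.uncurry (picardIterate X n))
      (Function.uncurry Φ) Filter.atTop (Set.Icc 0 1 ×ˢ W) := by
    rw [Metric.tendstoUniformlyOn_iff]
    intro e he
    filter_upwards [hzero.eventually (gt_mem_nhds he)] with n hn q hq
    rw [dist_comm]
    exact (hest n q.1 hq.1 q.2 hq.2).trans_lt hn
  have hcont : ContinuousOn (Function.uncurry Φ) (Set.Icc 0 1 ×ˢ W) :=
    hunif.continuousOn (Filter.Frequently.of_forall fun n => (h.picardIterate_spec n).1)
  have hdisp : ∀ t ∈ Set.Icc (0 : ℝ) 1, ∀ p ∈ W, ‖Φ t p - p‖ ≤ M := fun t ht p hp =>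
    le_of_tendsto ((hlim t ht p hp).sub_const p).norm
      (Filter.Eventually.of_forall fun n => (h.picardIterate_spec n).2.2 t ht p hp)
  have heq : ∀ t ∈ Set.Icc (0 : ℝ) 1, ∀ p ∈ W, Φ t p = p + ∫ s in (0 : ℝ)..t, X (Φ s p) := by
    intro t ht p hp
    refine tendsto_nhds_unique ((hlim t ht p hp).comp (Filter.tendsto_add_atTop_nat 1)) ?_
    rw [tendsto_iff_norm_sub_tendsto_zero]
    refine squeeze_zero (fun _ => norm_nonneg _) (fun n => ?_)
      (by simpa using hzero.const_mul K)
    have := h.norm_integral_sub_le hp (continuousOn_slice (h.picardIterate_spec n).1 hp)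
      (continuousOn_slice hcont hp) (fun s hs => (h.picardIterate_spec n).2.2 s hs p hp)
      (fun s hs => hdisp s hs p hp) (C := M * K ^ n / (1 - K))
      (div_nonneg (by positivity) (by linarith))
      (fun s hs => by rw [← dist_eq_norm]; exact hest n s hs p hp) ht
    simpa [picardIterate] using this
  refine ⟨Φ, ⟨hcont, fun t ht => ?_, hdisp, heq⟩, fun t ht p hp hLp => ?_⟩
  · refine TendstoUniformlyOn.analyticOnNhd_of_finiteDimensional (f := fun n => picardIterate X n t)
      h.isOpen_start ?_ fun n => (h.picardIterate_spec n).2.1 t ht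
    exact (hunif.comp fun p => (t, p)).mono fun p hp => ⟨ht, hp⟩
  · have hn : ∀ n, ∀ t ∈ Set.Icc (0 : ℝ) 1, L (picardIterate X n t p) = 0 := by
      intro n
      induction n with
      | zero => exact fun _ _ => hLp
      | succ n ih =>
        intro t ht
        have hsub : Set.uIcc (0 : ℝ) t ⊆ Set.Icc 0 1 := by
          rw [Set.uIcc_of_le ht.1]
          exact Set.Icc_subset_Icc_right ht.2
        have hmem : ∀ s ∈ Set.Icc (0 : ℝ) 1, picardIterate X n s p ∈ U := fun s hs =>
          h.mem_of_norm_sub_le hp ((h.picardIterate_spec n).2.2 s hs p hp)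
        have hint : IntervalIntegrable (fun s => X (picardIterate X n s p))
            MeasureTheory.volume 0 t :=
          ((h.differentiableOn.continuousOn.comp
            (continuousOn_slice (h.picardIterate_spec n).1 hp) hmem).mono hsub).intervalIntegrable
        have h0 : L (∫ s in (0 : ℝ)..t, X (picardIterate X n s p)) = 0 := by
          rw [← L.intervalIntegral_comp_comm hint]
          exact intervalIntegral.integral_zero_ae (MeasureTheory.ae_of_all _ fun s hs =>
            hL _ (hmem s (hsub (Set.uIoc_subset_uIcc hs))) (ih s (hsub (Set.uIoc_subset_uIcc hs))))
        change L (p + ∫ s in (0 : ℝ)..t, X (picardIterate X n s p)) = 0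
        rw [map_add, hLp, h0, add_zero]
    refine tendsto_nhds_unique ((L.continuous.tendsto _).comp (hlim t ht p hp)) ?_
    exact tendsto_const_nhds.congr fun n => (hn n t ht).symm

lemma hasDerivWithinAt_of_eq_integral {F : Type*} [NormedAddCommGroup F] [NormedSpace ℝ F]
    [CompleteSpace F] {γ u : ℝ → F} {x : F} (hu : ContinuousOn u (Set.Icc 0 1))
    (h : ∀ t ∈ Set.Icc (0 : ℝ) 1, γ t = x + ∫ s in (0 : ℝ)..t, u s) {t : ℝ}
    (ht : t ∈ Set.Icc (0 : ℝ) 1) : HasDerivWithinAt γ (u t) (Set.Icc 0 1) t := by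
  have := ODE.hasDerivWithinAt_picard_Icc (f := fun t _ => u t) (α := fun _ => x) (u := Set.univ)
    (t₀ := 0) (by simp) (hu.comp continuousOn_fst fun q hq => hq.1) continuousOn_const
    (fun _ _ => Set.mem_univ _) x ht
  exact this.congr (fun s hs => h s hs) (h t ht)

namespace IsFlow

variable {Φ : ℝ → E → E}

lemma hasDerivWithinAt (h : IsSlowField X U W M ρ) (hΦ : IsFlow X Φ W M) {p : E} (hp : p ∈ W)
    {t : ℝ} (ht : t ∈ Set.Icc (0 : ℝ) 1) :
    HasDerivWithinAt (fun s => Φ s p) (X (Φ t p)) (Set.Icc 0 1) t := by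
  have : CompleteSpace E := FiniteDimensional.complete ℂ E
  exact hasDerivWithinAt_of_eq_integral (u := fun s => X (Φ s p))
    ((continuousOn_field h hΦ).comp (f := fun s : ℝ => (s, p)) (by fun_prop)
      fun s hs => ⟨hs, hp⟩) (fun s hs => hΦ.eq_integral s hs p hp) ht

/-- The derivative of the flow in the initial point solves the variational equation. -/
lemma hasDerivWithinAt_fderiv (h : IsSlowField X U W M ρ) (hΦ : IsFlow X Φ W M) {p : E}
    (hp : p ∈ W) (v : E) {t : ℝ} (ht : t ∈ Set.Icc (0 : ℝ) 1) :
    HasDerivWithinAt (fun s => fderiv ℂ (Φ s) p v)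
      (fderiv ℂ X (Φ t p) (fderiv ℂ (Φ t) p v)) (Set.Icc 0 1) t := by
  have : CompleteSpace E := FiniteDimensional.complete ℂ E
  have hcomp : ∀ s ∈ Set.Icc (0 : ℝ) 1, DifferentiableOn ℂ (fun q => X (Φ s q)) W := fun s hs =>
    h.differentiableOn.comp (hΦ.analyticOnNhd s hs).differentiableOn fun q hq =>
      hΦ.mem_domain h hs hq
  have hchain : ∀ s ∈ Set.Icc (0 : ℝ) 1, fderiv ℂ (fun q => X (Φ s q)) p v
      = fderiv ℂ X (Φ s p) (fderiv ℂ (Φ s) p v) := by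
    intro s hs
    have h1 := (h.differentiableOn.differentiableAt (h.isOpen_domain.mem_nhds
      (hΦ.mem_domain h hs hp))).hasFDerivAt
    have h2 := (hΦ.analyticOnNhd s hs p hp).differentiableAt.hasFDerivAt
    have h3 : HasFDerivAt (fun q => X (Φ s q)) _ p := h1.comp p h2
    rw [h3.fderiv]
    rfl
  rw [← hchain t ht]
  refine hasDerivWithinAt_of_eq_integral (x := v)
    ((hasFDerivAt_intervalIntegral_of_holomorphic zero_le_one h.isOpen_start
      (continuousOn_field h hΦ) hcomp).2 p hp v).1 (fun s hs => ?_) ht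
  have hsub : Set.Icc (0 : ℝ) s ⊆ Set.Icc 0 1 := Set.Icc_subset_Icc_right hs.2
  obtain ⟨hI, hD⟩ := hasFDerivAt_intervalIntegral_of_holomorphic hs.1 h.isOpen_start
    ((continuousOn_field h hΦ).mono (Set.prod_mono hsub subset_rfl))
    fun s hs => hcomp s (hsub hs)
  have hev : Φ s =ᶠ[nhds p] fun q => q + ∫ τ in (0 : ℝ)..s, X (Φ τ q) := by
    filter_upwards [h.isOpen_start.mem_nhds hp] with q hq using hΦ.eq_integral s hs q hq
  rw [← (hD p hp v).2, hev.fderiv_eq,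
    fderiv_fun_add differentiableAt_fun_id (hI p hp).differentiableAt]
  simp

/-- Two solutions with the same time-one value stay in a common ball on which the field is
Lipschitz, so they coincide. -/
lemma injOn (h : IsSlowField X U W M ρ) (hΦ : IsFlow X Φ W M) : Set.InjOn (Φ 1) W := by
  intro p hp q hq hpq
  have h1 : (1 : ℝ) ∈ Set.Icc (0 : ℝ) 1 := by simp
  have hM := h.nonneg
  have hq3 : ∀ t ∈ Set.Icc (0 : ℝ) 1, ‖Φ t q - p‖ ≤ 3 * M := by
    intro t ht
    have e : Φ t q - p = (Φ t q - q) - (Φ 1 q - q) + (Φ 1 p - p) := by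
      rw [hpq]
      abel
    rw [e]
    have a := hΦ.norm_sub_le t ht q hq
    have b := hΦ.norm_sub_le 1 h1 q hq
    have c := hΦ.norm_sub_le 1 h1 p hp
    exact (norm_add_le _ _).trans (by linarith [_root_.norm_sub_le (Φ t q - q) (Φ 1 q - q)])
  have huniq := ODE_solution_unique_of_mem_Icc_left (v := fun _ => X) (a := 0) (b := 1)
    (K := ⟨M / (ρ - 3 * M), h.const_nonneg⟩) (s := fun _ => Metric.closedBall p (3 * M))
    (f := fun t => Φ t p) (g := fun t => Φ t q)
    (fun t _ => LipschitzOnWith.of_dist_le_mul fun x hx y hy => by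
      rw [dist_eq_norm, dist_eq_norm]
      exact h.norm_sub_le hp (mem_closedBall_iff_norm.1 hx) (mem_closedBall_iff_norm.1 hy))
    (continuousOn_slice hΦ.continuousOn hp)
    (fun t ht => (hΦ.hasDerivWithinAt h hp (Set.Ioc_subset_Icc_self ht)).mono_of_mem_nhdsWithin
      (Icc_mem_nhdsLE_of_mem ht))
    (fun t ht => by
      rw [mem_closedBall_iff_norm]
      linarith [hΦ.norm_sub_le t (Set.Ioc_subset_Icc_self ht) p hp])
    (continuousOn_slice hΦ.continuousOn hq)
    (fun t ht => (hΦ.hasDerivWithinAt h hq (Set.Ioc_subset_Icc_self ht)).mono_of_mem_nhdsWithin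
      (Icc_mem_nhdsLE_of_mem ht))
    (fun t ht => by
      rw [mem_closedBall_iff_norm]
      exact hq3 t (Set.Ioc_subset_Icc_self ht))
    hpq
  simpa [hΦ.apply_zero hp, hΦ.apply_zero hq] using huniq (x := 0) (by simp)

end IsFlow

end FiniteDimensional

end Flow

/-! ### Hamiltonian flows -/

section HamiltonianField

variable {ι : Type} [Fintype ι]

/-- The coordinate of index `i`, as a linear form. -/
noncomputable def coordCLM (i : ι × Fin 2) : Darboux ι →L[ℂ] ℂ := EuclideanSpace.proj i

lemma coordCLM_apply (i : ι × Fin 2) (w : Darboux ι) : coordCLM i w = w i := rfl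

lemma sympForm_swap (u v : Darboux ι) : sympForm u v = -sympForm v u := by
  simp only [sympForm, ← Finset.sum_neg_distrib]
  exact Finset.sum_congr rfl fun j _ => by ring

/-- The symplectic form with its second argument fixed. -/
noncomputable def sympFormCLM (v : Darboux ι) : Darboux ι →L[ℂ] ℂ :=
  ∑ j : ι, (v (j, 1) • coordCLM (j, 0)
    - v (j, 0) • coordCLM (j, 1))

lemma sympFormCLM_apply (u v : Darboux ι) : sympFormCLM v u = sympForm u v := by
  simp only [sympFormCLM, sympForm, sum_apply, sub_apply,
    smul_apply, coordCLM_apply, smul_eq_mul]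
  exact Finset.sum_congr rfl fun j _ => by ring

lemma HasDerivWithinAt.sympForm {u v : ℝ → Darboux ι} {u' v' : Darboux ι} {s : Set ℝ} {t : ℝ}
    (hu : HasDerivWithinAt u u' s t) (hv : HasDerivWithinAt v v' s t) :
    HasDerivWithinAt (fun t => sympForm (u t) (v t))
      (_root_.sympForm u' (v t) + _root_.sympForm (u t) v') s t := by
  have hc : ∀ {u : ℝ → Darboux ι} {u' : Darboux ι}, HasDerivWithinAt u u' s t →
      ∀ i, HasDerivWithinAt (fun t => u t i) (u' i) s t := fun h i =>
    ((coordCLM i).restrictScalars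
      ℝ).hasFDerivAt.comp_hasDerivWithinAt t h
  have h := HasDerivWithinAt.fun_sum (u := Finset.univ) fun (j : ι) _ =>
    (((hc hu (j, 0)).mul (hc hv (j, 1))).sub ((hc hu (j, 1)).mul (hc hv (j, 0))))
  refine h.congr_deriv ?_
  simp only [_root_.sympForm, ← Finset.sum_add_distrib]
  exact Finset.sum_congr rfl fun j _ => by ring

/-- The vector `v = J w̄`, whose symplectic product with any vector is the Hermitian product
with `w`. -/
noncomputable def conjRotate (w : Darboux ι) : Darboux ι :=
  WithLp.toLp 2 fun i => ![-starRingEnd ℂ (w (i.1, 1)), starRingEnd ℂ (w (i.1, 0))] i.2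

lemma norm_sq_eq_sum (w : Darboux ι) :
    ‖w‖ ^ 2 = ∑ j : ι, (‖w (j, 0)‖ ^ 2 + ‖w (j, 1)‖ ^ 2) := by
  rw [EuclideanSpace.norm_sq_eq, Fintype.sum_prod_type]
  simp

lemma norm_conjRotate (w : Darboux ι) : ‖conjRotate w‖ = ‖w‖ := by
  rw [← sq_eq_sq₀ (norm_nonneg _) (norm_nonneg _), norm_sq_eq_sum, norm_sq_eq_sum]
  refine Finset.sum_congr rfl fun j _ => ?_
  simp only [conjRotate, Matrix.cons_val_zero, Matrix.cons_val_one, norm_neg, RCLike.norm_conj]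
  ring

lemma sympForm_conjRotate (u w : Darboux ι) : sympForm u (conjRotate w)
    = ∑ j : ι, (u (j, 0) * starRingEnd ℂ (w (j, 0)) + u (j, 1) * starRingEnd ℂ (w (j, 1))) := by
  simp only [sympForm, conjRotate, Matrix.cons_val_zero, Matrix.cons_val_one]
  exact Finset.sum_congr rfl fun j _ => by ring

variable [DecidableEq ι]

/-- The Hamiltonian vector field of `χ`, with components `∂χ/∂p_j` and `-∂χ/∂q_j`. -/
noncomputable def hamField (χ : Darboux ι → ℂ) (p : Darboux ι) : Darboux ι :=
  WithLp.toLp 2 fun i => ![partialDeriv χ (i.1, 1) p, -partialDeriv χ (i.1, 0) p] i.2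

lemma clm_apply_eq_sum {F : Type*} [NormedAddCommGroup F] [NormedSpace ℂ F]
    (L : Darboux ι →L[ℂ] F) (v : Darboux ι) : L v = ∑ j : ι,
      (v (j, 0) • L (EuclideanSpace.single (j, 0) 1)
        + v (j, 1) • L (EuclideanSpace.single (j, 1) 1)) := by
  have h : v = ∑ i : ι × Fin 2, v i • EuclideanSpace.single i (1 : ℂ) := by
    have := (EuclideanSpace.basisFun (ι × Fin 2) ℂ).sum_repr v
    simpa using this.symm
  conv_lhs => rw [h]
  rw [map_sum, Fintype.sum_prod_type]
  simp

lemma poisson_eq_fderiv (F χ : Darboux ι → ℂ) (p : Darboux ι) :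
    poisson F χ p = fderiv ℂ F p (hamField χ p) := by
  rw [clm_apply_eq_sum, poisson]
  refine Finset.sum_congr rfl fun j _ => ?_
  simp only [hamField, partialDeriv, Matrix.cons_val_zero, Matrix.cons_val_one, smul_eq_mul]
  ring

lemma poisson_swap (F G : Darboux ι → ℂ) (p : Darboux ι) : poisson F G p = -poisson G F p := by
  simp only [poisson, ← Finset.sum_neg_distrib]
  exact Finset.sum_congr rfl fun j _ => by ring

lemma sympForm_hamField (χ : Darboux ι → ℂ) (p v : Darboux ι) :
    sympForm (hamField χ p) v = fderiv ℂ χ p v := by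
  rw [clm_apply_eq_sum, sympForm]
  refine Finset.sum_congr rfl fun j _ => ?_
  simp only [hamField, partialDeriv, Matrix.cons_val_zero, Matrix.cons_val_one, smul_eq_mul]
  ring

/-- The Euclidean norm of the Hamiltonian field is at most the operator norm of the differential:
evaluate the differential at `conjRotate (hamField χ p)`. -/
lemma norm_hamField_le (χ : Darboux ι → ℂ) (p : Darboux ι) :
    ‖hamField χ p‖ ≤ ‖fderiv ℂ χ p‖ := by
  set w := hamField χ p with hw
  have h1 : (‖w‖ : ℂ) ^ 2 = fderiv ℂ χ p (conjRotate w) := by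
    rw [← sympForm_hamField, ← hw, sympForm_conjRotate]
    have := norm_sq_eq_sum w
    simp only [Complex.mul_conj, Complex.normSq_eq_norm_sq]
    exact_mod_cast this
  have h2 : ‖w‖ ^ 2 ≤ ‖fderiv ℂ χ p‖ * ‖w‖ := by
    have := (fderiv ℂ χ p).le_opNorm (conjRotate w)
    rw [norm_conjRotate, ← h1] at this
    simpa using this
  rcases eq_or_lt_of_le (norm_nonneg w) with h0 | h0
  · rw [← h0]
    exact norm_nonneg _
  · exact le_of_mul_le_mul_right (by linarith [sq ‖w‖]) h0

lemma differentiableOn_hamField {χ : Darboux ι → ℂ} {U : Set (Darboux ι)}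
    (hχ : AnalyticOnNhd ℂ χ U) : DifferentiableOn ℂ (hamField χ) U := by
  have hpd : ∀ i, DifferentiableOn ℂ (partialDeriv χ i) U := fun i =>
    hχ.fderiv.differentiableOn.clm_apply (differentiableOn_const _)
  rw [differentiableOn_euclidean]
  rintro ⟨j, k⟩
  fin_cases k
  · exact hpd (j, 1)
  · exact (hpd (j, 0)).neg

/-- The derivative of a Hamiltonian field is infinitesimally symplectic, by the symmetry of the
second derivative of the Hamiltonian. -/
lemma sympForm_fderiv_hamField {χ : Darboux ι → ℂ} {U : Set (Darboux ι)} (hU : IsOpen U)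
    (hχ : AnalyticOnNhd ℂ χ U) {p : Darboux ι} (hp : p ∈ U) (u v : Darboux ι) :
    sympForm (fderiv ℂ (hamField χ) p u) v + sympForm u (fderiv ℂ (hamField χ) p v) = 0 := by
  have key : ∀ u v, sympForm (fderiv ℂ (hamField χ) p u) v
      = fderiv ℂ (fderiv ℂ χ) p u v := by
    intro u v
    have h1 : HasFDerivAt (fun q => sympFormCLM v (hamField χ q)) _ p :=
      (sympFormCLM v).hasFDerivAt.comp p
        ((differentiableOn_hamField hχ).differentiableAt (hU.mem_nhds hp)).hasFDerivAt
    have h2 : HasFDerivAt (fun q => fderiv ℂ χ q v) _ p :=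
      (ContinuousLinearMap.apply ℂ ℂ v).hasFDerivAt.comp p
        (hχ.fderiv p hp).differentiableAt.hasFDerivAt
    have he : (fun q => sympFormCLM v (hamField χ q)) = fun q => fderiv ℂ χ q v := by
      funext q
      rw [sympFormCLM_apply, sympForm_hamField]
    rw [he] at h1
    have h3 := DFunLike.congr_fun (h1.unique h2) u
    rw [← sympFormCLM_apply]
    exact h3
  have hsymm : IsSymmSndFDerivAt ℂ χ p :=
    ((hχ p hp).contDiffAt (n := 2)).isSymmSndFDerivAt (by simp)
  rw [sympForm_swap u, key, key, hsymm u v]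
  ring

/-- A Hamiltonian flow is symplectic: along the variational equation the symplectic product of two
solutions is constant. -/
lemma IsFlow.sympForm_fderiv {χ : Darboux ι → ℂ} {U W : Set (Darboux ι)} {M ρ : ℝ}
    {Φ : ℝ → Darboux ι → Darboux ι} (hχ : AnalyticOnNhd ℂ χ U)
    (h : IsSlowField (hamField χ) U W M ρ) (hΦ : IsFlow (hamField χ) Φ W M) {p : Darboux ι}
    (hp : p ∈ W) (u v : Darboux ι) :
    sympForm (fderiv ℂ (Φ 1) p u) (fderiv ℂ (Φ 1) p v) = sympForm u v := by
  have hder : ∀ t ∈ Set.Icc (0 : ℝ) 1, HasDerivWithinAt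
      (fun s => sympForm (fderiv ℂ (Φ s) p u) (fderiv ℂ (Φ s) p v)) 0 (Set.Icc 0 1) t := by
    intro t ht
    refine ((hΦ.hasDerivWithinAt_fderiv h hp u ht).sympForm
      (hΦ.hasDerivWithinAt_fderiv h hp v ht)).congr_deriv ?_
    exact sympForm_fderiv_hamField h.isOpen_domain hχ (hΦ.mem_domain h ht hp) _ _
  have hconst := constant_of_has_deriv_right_zero
    (fun t ht => (hder t ht).continuousWithinAt)
    (fun t ht => (hder t (Set.Ico_subset_Icc_self ht)).mono_of_mem_nhdsWithin
      (Icc_mem_nhdsGE_of_mem ht)) 1 (by simp)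
  have h0 : fderiv ℂ (Φ 0) p = ContinuousLinearMap.id ℂ _ := by
    have hev : Φ 0 =ᶠ[nhds p] fun q => q := by
      filter_upwards [h.isOpen_start.mem_nhds hp] with q hq using hΦ.apply_zero hq
    rw [hev.fderiv_eq]
    exact fderiv_id
  simpa [h0] using hconst

/-- The derivative of a function along a Hamiltonian flow is its Poisson bracket with the
Hamiltonian. -/
lemma IsFlow.hasDerivWithinAt_comp {χ F : Darboux ι → ℂ} {U W : Set (Darboux ι)} {M ρ : ℝ}
    {Φ : ℝ → Darboux ι → Darboux ι}
    (h : IsSlowField (hamField χ) U W M ρ) (hΦ : IsFlow (hamField χ) Φ W M) {p : Darboux ι}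
    (hp : p ∈ W) {t : ℝ} (ht : t ∈ Set.Icc (0 : ℝ) 1) (hF : DifferentiableAt ℂ F (Φ t p)) :
    HasDerivWithinAt (fun s => F (Φ s p)) (poisson F χ (Φ t p)) (Set.Icc 0 1) t := by
  rw [poisson_eq_fderiv]
  exact (hF.hasFDerivAt.restrictScalars ℝ).comp_hasDerivWithinAt t
    (hΦ.hasDerivWithinAt h hp ht)

/-- The vector of imaginary parts. -/
noncomputable def imCLM (ι : Type) [Fintype ι] : Darboux ι →L[ℝ] (ι × Fin 2 → ℝ) :=
  ContinuousLinearMap.pi fun i => Complex.imCLM.comp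
    ((coordCLM i).restrictScalars ℝ)

omit [DecidableEq ι] in
lemma imCLM_eq_zero_iff {w : Darboux ι} : imCLM ι w = 0 ↔ w ∈ realVectors ι := by
  simp [imCLM, funext_iff, realVectors, coordCLM_apply]

omit [DecidableEq ι] in
/-- Differential of a real analytic function at a real point: it is real in real directions. -/
lemma fderiv_mem_realScalars {χ : Darboux ι → ℂ} {U : Set (Darboux ι)} (hU : IsOpen U)
    (hχ : RealAnalyticOn (realVectors ι) realScalars χ U) {p : Darboux ι} (hp : p ∈ U)
    (hp' : p ∈ realVectors ι) {v : Darboux ι} (hv : v ∈ realVectors ι) :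
    fderiv ℂ χ p v ∈ realScalars := by
  have hline : HasDerivAt (fun t : ℝ => p + (t : ℂ) • v) v 0 := by
    simpa using (((Complex.ofRealCLM.hasDerivAt (x := (0 : ℝ))).smul_const v).const_add p)
  have hd : HasFDerivAt χ (fderiv ℂ χ p) (p + ((0 : ℝ) : ℂ) • v) := by
    simpa using (hχ.1 p hp).differentiableAt.hasFDerivAt
  have h1 : HasDerivAt (fun t : ℝ => χ (p + (t : ℂ) • v)) (fderiv ℂ χ p v) 0 :=
    (hd.restrictScalars ℝ).comp_hasDerivAt (f := fun t : ℝ => p + (t : ℂ) • v) (0 : ℝ) hline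
  have h2 : HasDerivAt (fun t : ℝ => (χ (p + (t : ℂ) • v)).im) (fderiv ℂ χ p v).im 0 :=
    Complex.imCLM.hasFDerivAt.comp_hasDerivAt (0 : ℝ) h1
  have h3 : (fun t : ℝ => (χ (p + (t : ℂ) • v)).im) =ᶠ[nhds 0] fun _ => 0 := by
    have hc : Continuous fun t : ℝ => p + (t : ℂ) • v := by fun_prop
    filter_upwards [(hU.preimage hc).mem_nhds (by simpa using hp)] with t ht
    refine hχ.2 ⟨ht, fun i => ?_⟩
    simp [hp' i, hv i]
  exact h2.unique ((hasDerivAt_const (0 : ℝ) (0 : ℝ)).congr_of_eventuallyEq h3)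

lemma hamField_mem_realVectors {χ : Darboux ι → ℂ} {U : Set (Darboux ι)} (hU : IsOpen U)
    (hχ : RealAnalyticOn (realVectors ι) realScalars χ U) {p : Darboux ι} (hp : p ∈ U)
    (hp' : p ∈ realVectors ι) : hamField χ p ∈ realVectors ι := by
  have hpd : ∀ i, (partialDeriv χ i p).im = 0 := by
    intro i
    refine fderiv_mem_realScalars hU hχ hp hp' fun k => ?_
    rw [PiLp.single_apply]
    split_ifs <;> simp
  rintro ⟨j, k⟩
  fin_cases k
  · exact hpd (j, 1)
  · simpa [hamField] using hpd (j, 0)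

/-- The time-one map of a slow real analytic Hamiltonian flow is a real analytic symplectic
transformation. -/
theorem IsSlowField.exists_symplectic_flow {χ : Darboux ι → ℂ} {U W : Set (Darboux ι)} {M ρ : ℝ}
    (h : IsSlowField (hamField χ) U W M ρ)
    (hχ : RealAnalyticOn (realVectors ι) realScalars χ U) :
    ∃ Φ : ℝ → Darboux ι → Darboux ι, IsFlow (hamField χ) Φ W M ∧
      IsSymplecticTransformation (Φ 1) W := by
  obtain ⟨Φ, hΦ, hreal⟩ := h.exists_flow (imCLM ι) fun x hx hx0 =>
    imCLM_eq_zero_iff.2 (hamField_mem_realVectors h.isOpen_domain hχ hx (imCLM_eq_zero_iff.1 hx0))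
  refine ⟨Φ, hΦ, ⟨hΦ.analyticOnNhd 1 (by simp), fun p hp => ?_⟩, hΦ.injOn h,
    fun p hp => hΦ.sympForm_fderiv hχ.1 h hp⟩
  exact imCLM_eq_zero_iff.1 (hreal 1 (by simp) p hp.1 (imCLM_eq_zero_iff.2 hp.2))

end HamiltonianField

/-! ### Complex rotations and the actions -/

section Rotations

variable {n N : ℕ}

/-- The form `∑ a_j I_j` in the actions. -/
noncomputable def actionForm (a : Fin n → ℂ) (p : Phase n N) : ℂ :=
  ∑ j, a j * actions (zPart p) j

/-- The Hamiltonian field of `∑ a_j I_j`: the infinitesimal rotation of the planes `(x_j, y_j)`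
with velocities `a_j`. -/
noncomputable def rotGen (a : Fin n → ℂ) (p : Phase n N) : Phase n N :=
  WithLp.toLp 2 fun i => Sum.elim
    (fun j => ![a j * p (Sum.inl j, 1), -(a j * p (Sum.inl j, 0))] i.2) (fun _ => 0) i.1

/-- The rotation of the planes `(x_j, y_j)` by the complex angles `α_j`. -/
noncomputable def rot (α : Fin n → ℂ) : Phase n N →L[ℂ] Phase n N :=
  LinearMap.toContinuousLinearMap
    { toFun := fun p => WithLp.toLp 2 fun i => Sum.elim
        (fun j => ![Complex.cos (α j) * p (Sum.inl j, 0) + Complex.sin (α j) * p (Sum.inl j, 1),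
          -Complex.sin (α j) * p (Sum.inl j, 0) + Complex.cos (α j) * p (Sum.inl j, 1)] i.2)
        (fun j => p (Sum.inr j, i.2)) i.1
      map_add' := fun p q => by
        ext ⟨j | j, k⟩
        · fin_cases k <;> simp <;> ring
        · simp
      map_smul' := fun c p => by
        ext ⟨j | j, k⟩
        · fin_cases k <;> simp <;> ring
        · simp }

lemma rot_apply_zero (α : Fin n → ℂ) (p : Phase n N) (j : Fin n) : rot α p (Sum.inl j, 0)
    = Complex.cos (α j) * p (Sum.inl j, 0) + Complex.sin (α j) * p (Sum.inl j, 1) := rfl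

lemma rot_apply_one (α : Fin n → ℂ) (p : Phase n N) (j : Fin n) : rot α p (Sum.inl j, 1)
    = -Complex.sin (α j) * p (Sum.inl j, 0) + Complex.cos (α j) * p (Sum.inl j, 1) := rfl

lemma rot_apply_inr (α : Fin n → ℂ) (p : Phase n N) (j : Fin N) (k : Fin 2) :
    rot α p (Sum.inr j, k) = p (Sum.inr j, k) := rfl

lemma rotGen_apply_zero (a : Fin n → ℂ) (p : Phase n N) (j : Fin n) :
    rotGen a p (Sum.inl j, 0) = a j * p (Sum.inl j, 1) := rfl

lemma rotGen_apply_one (a : Fin n → ℂ) (p : Phase n N) (j : Fin n) :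
    rotGen a p (Sum.inl j, 1) = -(a j * p (Sum.inl j, 0)) := rfl

lemma rotGen_apply_inr (a : Fin n → ℂ) (p : Phase n N) (j : Fin N) (k : Fin 2) :
    rotGen a p (Sum.inr j, k) = 0 := rfl

lemma rotGen_zero (p : Phase n N) : rotGen 0 p = 0 := by
  ext ⟨j | j, k⟩
  · fin_cases k
    · simp [rotGen_apply_zero]
    · simp [rotGen_apply_one]
  · simp [rotGen_apply_inr]

lemma rot_zero (p : Phase n N) : rot 0 p = p := by
  ext ⟨j | j, k⟩
  · fin_cases k
    · simp [rot_apply_zero]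
    · simp [rot_apply_one]
  · simp [rot_apply_inr]

lemma rot_of_two_pi {α : Fin n → ℂ} (hα : ∀ j, ∃ k : ℤ, α j = k * (2 * Real.pi))
    (p : Phase n N) : rot α p = p := by
  have hc : ∀ j, Complex.cos (α j) = 1 := fun j => by
    obtain ⟨k, hk⟩ := hα j
    rw [hk, Complex.cos_int_mul_two_pi]
  have hs : ∀ j, Complex.sin (α j) = 0 := fun j => by
    obtain ⟨k, hk⟩ := hα j
    rw [hk, show (k : ℂ) * (2 * Real.pi) = ((2 * k : ℤ) : ℂ) * Real.pi by push_cast; ring,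
      Complex.sin_int_mul_pi]
  ext ⟨j | j, k⟩
  · fin_cases k
    · simp [rot_apply_zero, hc, hs]
    · simp [rot_apply_one, hc, hs]
  · simp [rot_apply_inr]

lemma rot_mem_realVectors {α : Fin n → ℝ} {p : Phase n N} (hp : p ∈ realVectors (Fin n ⊕ Fin N)) :
    rot (fun j => (α j : ℂ)) p ∈ realVectors (Fin n ⊕ Fin N) := by
  rintro ⟨j | j, k⟩
  · have h0 := hp (Sum.inl j, 0)
    have h1 := hp (Sum.inl j, 1)
    fin_cases k
    · simp [rot_apply_zero, h0, h1, ← Complex.ofReal_cos, ← Complex.ofReal_sin]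
    · simp [rot_apply_one, h0, h1, ← Complex.ofReal_cos, ← Complex.ofReal_sin]
  · exact hp (Sum.inr j, k)

lemma hasDerivAt_rot (a : Fin n → ℂ) (p : Phase n N) (t : ℂ) :
    HasDerivAt (fun s : ℂ => rot (s • a) p) (rot (t • a) (rotGen a p)) t := by
  rw [hasDerivAt_iff_hasFDerivAt, ← hasFDerivWithinAt_univ, hasFDerivWithinAt_euclidean]
  rintro ⟨j | j, k⟩
  · have h1 : HasDerivAt (fun s : ℂ => s * a j) (a j) t := by
      simpa using (hasDerivAt_id t).mul_const (a j)
    fin_cases k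
    · refine (((h1.ccos.mul_const (p (Sum.inl j, 0))).add (h1.csin.mul_const
        (p (Sum.inl j, 1)))).hasFDerivAt.congr_fderiv ?_).hasFDerivWithinAt
      ext
      simp [rot_apply_zero, rotGen_apply_zero, rotGen_apply_one]
      ring
    · refine (((h1.csin.neg.mul_const (p (Sum.inl j, 0))).add (h1.ccos.mul_const
        (p (Sum.inl j, 1)))).hasFDerivAt.congr_fderiv ?_).hasFDerivWithinAt
      ext
      simp [rot_apply_one, rotGen_apply_zero, rotGen_apply_one]
      ring
  · refine ((hasDerivAt_const t (p (Sum.inr j, k))).hasFDerivAt.congr_fderiv ?_).hasFDerivWithinAt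
    ext
    simp [rot_apply_inr, rotGen_apply_inr]

lemma actions_rot (α : Fin n → ℂ) (p : Phase n N) :
    actions (zPart (rot α p)) = actions (zPart p) := by
  funext j
  have h := Complex.sin_sq_add_cos_sq (α j)
  change (rot α p (Sum.inl j, 0) ^ 2 + rot α p (Sum.inl j, 1) ^ 2) / 2
    = (p (Sum.inl j, 0) ^ 2 + p (Sum.inl j, 1) ^ 2) / 2
  rw [rot_apply_zero, rot_apply_one]
  linear_combination (p (Sum.inl j, 0) ^ 2 + p (Sum.inl j, 1) ^ 2) / 2 * h

/-- In the coordinates `x ± i y`, a complex rotation is diagonal with entries `e^{∓ i α}`. -/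
lemma norm_sq_rotate_le (α x y : ℂ) {θ : ℝ} (h : |α.im| ≤ θ) :
    ‖Complex.cos α * x + Complex.sin α * y‖ ^ 2 + ‖-Complex.sin α * x + Complex.cos α * y‖ ^ 2
      ≤ Real.exp θ ^ 2 * (‖x‖ ^ 2 + ‖y‖ ^ 2) := by
  have par : ∀ u v : ℂ, ‖u + Complex.I * v‖ ^ 2 + ‖u - Complex.I * v‖ ^ 2
      = 2 * (‖u‖ ^ 2 + ‖v‖ ^ 2) := by
    intro u v
    have := parallelogram_law_with_norm ℝ u (Complex.I * v)
    simp only [norm_mul, Complex.norm_I, one_mul] at this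
    linarith
  have e1 : Complex.cos α * x + Complex.sin α * y
      + Complex.I * (-Complex.sin α * x + Complex.cos α * y)
      = Complex.exp (-α * Complex.I) * (x + Complex.I * y) := by
    rw [Complex.exp_mul_I, Complex.cos_neg, Complex.sin_neg]
    linear_combination (Complex.sin α * y) * Complex.I_sq
  have e2 : Complex.cos α * x + Complex.sin α * y
      - Complex.I * (-Complex.sin α * x + Complex.cos α * y)
      = Complex.exp (α * Complex.I) * (x - Complex.I * y) := by
    rw [Complex.exp_mul_I]
    linear_combination (Complex.sin α * y) * Complex.I_sq
  have n1 : ‖Complex.exp (-α * Complex.I)‖ ≤ Real.exp θ := by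
    rw [Complex.norm_exp]
    simpa using (le_abs_self _).trans h
  have n2 : ‖Complex.exp (α * Complex.I)‖ ≤ Real.exp θ := by
    rw [Complex.norm_exp]
    simpa using (neg_le_abs _).trans h
  have p1 := par (Complex.cos α * x + Complex.sin α * y) (-Complex.sin α * x + Complex.cos α * y)
  have p2 := par x y
  rw [e1, e2, norm_mul, norm_mul, mul_pow, mul_pow] at p1
  have q1 := mul_le_mul_of_nonneg_right (pow_le_pow_left₀ (norm_nonneg _) n1 2)
    (sq_nonneg ‖x + Complex.I * y‖)
  have q2 := mul_le_mul_of_nonneg_right (pow_le_pow_left₀ (norm_nonneg _) n2 2)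
    (sq_nonneg ‖x - Complex.I * y‖)
  nlinarith

lemma norm_zPart_rot_le {α : Fin n → ℂ} {θ : ℝ} (h : ∀ j, |(α j).im| ≤ θ) (p : Phase n N) :
    ‖zPart (rot α p)‖ ≤ Real.exp θ * ‖zPart p‖ := by
  rw [← sq_le_sq₀ (norm_nonneg _) (by positivity), mul_pow, norm_sq_eq_sum, norm_sq_eq_sum,
    Finset.mul_sum]
  exact Finset.sum_le_sum fun j _ => norm_sq_rotate_le _ _ _ (h j)

lemma rot_mem_dom {I₀ : Fin n → ℝ} {a b c θ : ℝ} {α : Fin n → ℂ} (h : ∀ j, |(α j).im| ≤ θ)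
    {p : Phase n N} (hp : p ∈ dom I₀ a b c) : rot α p ∈ dom I₀ a (Real.exp θ * b) c := by
  refine ⟨?_, (norm_zPart_rot_le h p).trans_lt
    (mul_lt_mul_of_pos_left hp.2.1 (Real.exp_pos _)), hp.2.2⟩
  simpa only [actionDev, actions_rot] using hp.1

lemma rot_real_mem_dom {I₀ : Fin n → ℝ} {a b c : ℝ} (α : Fin n → ℝ)
    {p : Phase n N} (hp : p ∈ dom I₀ a b c) :
    rot (fun j => (α j : ℂ)) p ∈ dom I₀ a b c := by
  simpa using rot_mem_dom (α := fun j => (α j : ℂ)) (θ := 0) (by simp) hp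

lemma continuous_zPart : Continuous (zPart : Phase n N → Darboux (Fin n)) := by
  unfold zPart
  fun_prop

lemma continuous_ζPart : Continuous (ζPart : Phase n N → Darboux (Fin N)) := by
  unfold ζPart
  fun_prop

lemma isOpen_dom (I₀ : Fin n → ℝ) (a b c : ℝ) : IsOpen (dom I₀ a b c : Set (Phase n N)) := by
  have hz := continuous_zPart (n := n) (N := N)
  have hζ := continuous_ζPart (n := n) (N := N)
  refine IsOpen.and (isOpen_lt ?_ continuous_const)
    ((isOpen_lt hz.norm continuous_const).and (isOpen_lt hζ.norm continuous_const))
  unfold actionDev actions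
  fun_prop

/-- The differential of the action `I_j`. -/
noncomputable def actionCLM (p : Phase n N) (j : Fin n) : Phase n N →L[ℂ] ℂ :=
  p (Sum.inl j, 0) • coordCLM (Sum.inl j, 0) + p (Sum.inl j, 1) • coordCLM (Sum.inl j, 1)

lemma hasFDerivAt_actions (p : Phase n N) (j : Fin n) :
    HasFDerivAt (fun q : Phase n N => actions (zPart q) j) (actionCLM p j) p := by
  have h : ∀ k : Fin 2, HasFDerivAt (fun q : Phase n N => q (Sum.inl j, k))
      (coordCLM (Sum.inl j, k)) p := fun k => (coordCLM (Sum.inl j, k)).hasFDerivAt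
  refine ((((h 0).pow 2).add ((h 1).pow 2)).mul_const (2 : ℂ)⁻¹).congr_fderiv ?_
  ext v
  simp [actionCLM]
  ring

lemma hasFDerivAt_actionForm (a : Fin n → ℂ) (p : Phase n N) :
    HasFDerivAt (actionForm a) (∑ j, a j • actionCLM p j) p :=
  HasFDerivAt.fun_sum fun j _ => (hasFDerivAt_actions p j).const_mul (a j)

lemma hamField_actionForm (a : Fin n → ℂ) (p : Phase n N) :
    hamField (actionForm a) p = rotGen a p := by
  ext ⟨j | j, k⟩
  · fin_cases k <;>
    simp [hamField, partialDeriv, (hasFDerivAt_actionForm a p).fderiv, actionCLM, coordCLM_apply,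
      rotGen]
  · fin_cases k <;>
    simp [hamField, partialDeriv, (hasFDerivAt_actionForm a p).fderiv, actionCLM, coordCLM_apply,
      rotGen]

lemma linHam_eq_actionForm (ω₀ : Fin n → ℝ) :
    (linHam ω₀ : Phase n N → ℂ) = actionForm fun j => (ω₀ j : ℂ) := rfl

lemma poisson_linHam (F : Phase n N → ℂ) (ω₀ : Fin n → ℝ) (p : Phase n N) :
    poisson F (linHam ω₀) p = fderiv ℂ F p (rotGen (fun j => (ω₀ j : ℂ)) p) := by
  rw [poisson_eq_fderiv, linHam_eq_actionForm, hamField_actionForm]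

/-- The vector `A (I - I⁰)`. -/
noncomputable def quadFreq (I₀ : Fin n → ℝ) (A : Matrix (Fin n) (Fin n) ℝ) (p : Phase n N) :
    Fin n → ℂ := fun i => ∑ j, (A i j : ℂ) * actionDev I₀ (zPart p) j

lemma hasFDerivAt_quadHam (I₀ : Fin n → ℝ) {A : Matrix (Fin n) (Fin n) ℝ} (hA : A.IsSymm)
    (p : Phase n N) :
    HasFDerivAt (quadHam I₀ A) (∑ i, quadFreq I₀ A p i • actionCLM p i) p := by
  have h : ∀ j, HasFDerivAt (fun q : Phase n N => actionDev I₀ (zPart q) j) (actionCLM p j) p :=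
    fun j => (hasFDerivAt_actions p j).sub_const _
  have h1 : HasFDerivAt (quadHam I₀ A) ((1 / 2 : ℂ) • ∑ i, ∑ j,
      (((A i j : ℂ) * actionDev I₀ (zPart p) j) • actionCLM p i
        + actionDev I₀ (zPart p) i • ((A i j : ℂ) • actionCLM p j))) p :=
    HasFDerivAt.const_mul (HasFDerivAt.fun_sum fun i _ => HasFDerivAt.fun_sum fun j _ =>
      ((h j).const_mul (A i j : ℂ)).mul (h i)) _
  refine h1.congr_fderiv ?_
  have e1 : ∑ i, ∑ j, ((A i j : ℂ) * actionDev I₀ (zPart p) j) • actionCLM p i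
      = ∑ i, quadFreq I₀ A p i • actionCLM p i := by
    exact Finset.sum_congr rfl fun i _ => (Finset.sum_smul ..).symm
  have e2 : ∑ i, ∑ j, actionDev I₀ (zPart p) i • ((A i j : ℂ) • actionCLM p j)
      = ∑ i, quadFreq I₀ A p i • actionCLM p i := by
    rw [Finset.sum_comm, ← e1]
    refine Finset.sum_congr rfl fun i _ => Finset.sum_congr rfl fun j _ => ?_
    rw [smul_smul, mul_comm, hA.apply i j]
  simp only [Finset.sum_add_distrib]
  rw [e1, e2, ← two_smul ℂ, smul_smul]
  norm_num

/-- At each point the quadratic part has the differential of the form in the actions with the frozen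
coefficients `A (I - I⁰)`. -/
lemma poisson_quadHam (I₀ : Fin n → ℝ) {A : Matrix (Fin n) (Fin n) ℝ} (hA : A.IsSymm)
    (χ : Phase n N → ℂ) (p : Phase n N) :
    poisson (quadHam I₀ A) χ p = -fderiv ℂ χ p (rotGen (quadFreq I₀ A p) p) := by
  have h : fderiv ℂ (quadHam I₀ A) p = fderiv ℂ (actionForm (quadFreq I₀ A p)) p := by
    rw [(hasFDerivAt_quadHam I₀ hA p).fderiv, (hasFDerivAt_actionForm _ p).fderiv]
  rw [poisson_eq_fderiv, h, ← poisson_eq_fderiv, poisson_swap, poisson_eq_fderiv,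
    hamField_actionForm]

/-- The `l¹` norm `∑ᵢ |Aᵢⱼ|` of each column is at most the operator norm, so the bound on real
vectors that defines the latter extends to the complex vector `I - I⁰`. -/
lemma norm_quadFreq_le (I₀ : Fin n → ℝ) (A : Matrix (Fin n) (Fin n) ℝ) (p : Phase n N)
    (i : Fin n) : ‖quadFreq I₀ A p i‖ ≤ l1OpNorm A * ∑ j, ‖actionDev I₀ (zPart p) j‖ := by
  have hA : ∀ j, |A i j| ≤ l1OpNorm A := by
    intro j
    have h := (LinearMap.toContinuousLinearMap (Matrix.toLpLin 1 1 A)).le_opNorm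
      (PiLp.single 1 j (1 : ℝ))
    have h1 : ‖PiLp.single (β := fun _ : Fin n => ℝ) 1 j (1 : ℝ)‖ = 1 := by simp
    rw [h1, mul_one] at h
    refine le_trans ?_ h
    rw [PiLp.norm_eq_of_L1]
    refine le_trans (le_of_eq ?_) (Finset.single_le_sum 
      (f := fun k => ‖(LinearMap.toContinuousLinearMap (Matrix.toLpLin 1 1 A)
        (PiLp.single (β := fun _ : Fin n => ℝ) 1 j (1 : ℝ))) k‖) (fun k _ => norm_nonneg _)
        (Finset.mem_univ i))
    simp [Matrix.toLpLin_apply]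
  refine (norm_sum_le _ _).trans ?_
  rw [Finset.mul_sum]
  refine Finset.sum_le_sum fun j _ => ?_
  rw [norm_mul, Complex.norm_real]
  exact mul_le_mul_of_nonneg_right (hA j) (norm_nonneg _)

end Rotations

/-! ### Averaging and the homological equation -/

section Averaging

variable {n N : ℕ}

/-- The flow of `⟨ω, I⟩` at time `t`. -/
noncomputable def linFlow (ω : Fin n → ℝ) (t : ℝ) : Phase n N →L[ℂ] Phase n N :=
  rot ((t : ℂ) • fun j => (ω j : ℂ))

lemma linFlow_eq_rot (ω : Fin n → ℝ) (t : ℝ) :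
    (linFlow ω t : Phase n N →L[ℂ] Phase n N) = rot fun j => ((t * ω j : ℝ) : ℂ) := by
  unfold linFlow
  congr 1
  funext j
  simp

lemma linFlow_zero (ω : Fin n → ℝ) (p : Phase n N) : linFlow ω 0 p = p := by
  simp [linFlow, rot_zero]

lemma linFlow_period {ω : Fin n → ℝ} {T : ℝ} (hω : ∀ j, ∃ k : ℤ, T * ω j = 2 * Real.pi * k)
    (p : Phase n N) : linFlow ω T p = p := by
  rw [linFlow_eq_rot]
  refine rot_of_two_pi (fun j => ?_) p
  obtain ⟨k, hk⟩ := hω j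
  refine ⟨k, ?_⟩
  rw [hk]
  push_cast
  ring

lemma continuous_linFlow (ω : Fin n → ℝ) :
    Continuous fun q : ℝ × Phase n N => linFlow ω q.1 q.2 := by
  refine (PiLp.continuous_toLp 2 _).comp (continuous_pi ?_)
  rintro ⟨j | j, k⟩
  · fin_cases k
    · change Continuous fun q : ℝ × Phase n N => Complex.cos ((q.1 : ℂ) * ω j) * q.2 (Sum.inl j, 0)
        + Complex.sin ((q.1 : ℂ) * ω j) * q.2 (Sum.inl j, 1)
      fun_prop
    · change Continuous fun q : ℝ × Phase n N => -Complex.sin ((q.1 : ℂ) * ω j)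
        * q.2 (Sum.inl j, 0) + Complex.cos ((q.1 : ℂ) * ω j) * q.2 (Sum.inl j, 1)
      fun_prop
  · change Continuous fun q : ℝ × Phase n N => q.2 (Sum.inr j, k)
    fun_prop

lemma hasDerivAt_linFlow (ω : Fin n → ℝ) (p : Phase n N) (t : ℝ) :
    HasDerivAt (fun s => linFlow ω s p) (linFlow ω t (rotGen (fun j => (ω j : ℂ)) p)) t :=
  (((hasDerivAt_rot (fun j => (ω j : ℂ)) p (t : ℂ)).scomp t
    Complex.ofRealCLM.hasDerivAt).congr_deriv (by simp; rfl))

lemma linFlow_mem_dom {I₀ : Fin n → ℝ} {a b c : ℝ} (ω : Fin n → ℝ) (t : ℝ)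
    {p : Phase n N} (hp : p ∈ dom I₀ a b c) : linFlow ω t p ∈ dom I₀ a b c := by
  rw [linFlow_eq_rot]
  exact rot_real_mem_dom _ hp

lemma linFlow_mem_realVectors (ω : Fin n → ℝ) (t : ℝ) {p : Phase n N}
    (hp : p ∈ realVectors (Fin n ⊕ Fin N)) : linFlow ω t p ∈ realVectors (Fin n ⊕ Fin N) := by
  rw [linFlow_eq_rot]
  exact rot_mem_realVectors hp

/-- The average of `f` along the flow of `⟨ω, I⟩` over `[0, T]`, with weight `c`. -/
noncomputable def flowAverage (ω : Fin n → ℝ) (T : ℝ) (c : ℝ → ℝ) (f : Phase n N → ℂ)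
    (p : Phase n N) : ℂ :=
  ∫ t in (0 : ℝ)..T, (c t : ℂ) * f (linFlow ω t p)

variable {I₀ : Fin n → ℝ} {a b d : ℝ} {ω : Fin n → ℝ} {T : ℝ} {c : ℝ → ℝ} {f : Phase n N → ℂ}

lemma flowAverage_continuousOn (hc : Continuous c) (hf : AnalyticOnNhd ℂ f (dom I₀ a b d)) :
    ContinuousOn (Function.uncurry fun t p => (c t : ℂ) * f (linFlow ω t p))
      (Set.Icc 0 T ×ˢ dom I₀ a b d) := by
  refine ContinuousOn.mul (by fun_prop) ?_
  exact hf.continuousOn.comp (continuous_linFlow ω).continuousOn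
    fun q hq => linFlow_mem_dom ω q.1 hq.2

lemma realAnalyticOn_flowAverage (hT : 0 ≤ T) (hc : Continuous c)
    (hf : RealAnalyticOn (realVectors (Fin n ⊕ Fin N)) realScalars f (dom I₀ a b d)) :
    RealAnalyticOn (realVectors (Fin n ⊕ Fin N)) realScalars (flowAverage ω T c f)
      (dom I₀ a b d) := by
  refine ⟨(hasFDerivAt_intervalIntegral_of_holomorphic hT (isOpen_dom I₀ a b d)
    (flowAverage_continuousOn hc hf.1) fun t _ => ?_).1, fun p hp => ?_⟩
  · refine DifferentiableOn.const_mul ?_ _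
    exact hf.1.differentiableOn.comp (linFlow ω t).differentiable.differentiableOn
      fun p hp => linFlow_mem_dom ω t hp
  · have hint : IntervalIntegrable (fun t => (c t : ℂ) * f (linFlow ω t p))
        MeasureTheory.volume 0 T := by
      refine ContinuousOn.intervalIntegrable ?_
      rw [Set.uIcc_of_le hT]
      exact (flowAverage_continuousOn hc hf.1).comp (f := fun t : ℝ => (t, p)) (by fun_prop)
        fun t ht => ⟨ht, hp.1⟩
    have h := Complex.imCLM.intervalIntegral_comp_comm hint
    change (flowAverage ω T c f p).im = 0
    refine h.symm.trans (intervalIntegral.integral_zero_ae (MeasureTheory.ae_of_all _ ?_))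
    intro t _
    have h1 : (f (linFlow ω t p)).im = 0 :=
      hf.2 ⟨linFlow_mem_dom ω t hp.1, linFlow_mem_realVectors ω t hp.2⟩
    simp [h1]

lemma norm_flowAverage_le (hT : 0 ≤ T) {C ε : ℝ} (hC0 : 0 ≤ C) (hC : ∀ t ∈ Set.Icc 0 T, |c t| ≤ C)
    (hf : ∀ p ∈ dom I₀ a b d, ‖f p‖ ≤ ε) {p : Phase n N} (hp : p ∈ dom I₀ a b d) :
    ‖flowAverage ω T c f p‖ ≤ C * ε * T := by
  have h : ‖flowAverage ω T c f p‖ ≤ C * ε * |T - 0| := by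
    refine intervalIntegral.norm_integral_le_of_norm_le_const fun t ht => ?_
    rw [Set.uIoc_of_le hT] at ht
    rw [norm_mul, Complex.norm_real]
    exact mul_le_mul (hC t ⟨ht.1.le, ht.2⟩) (hf _ (linFlow_mem_dom ω t hp)) (norm_nonneg _) hC0
  rwa [sub_zero, abs_of_nonneg hT] at h

/-- The bracket of an average with `⟨ω, I⟩` is the average of the derivative along the flow. -/
lemma poisson_flowAverage (hT : 0 ≤ T) (hc : Continuous c)
    (hf : AnalyticOnNhd ℂ f (dom I₀ a b d)) {p : Phase n N} (hp : p ∈ dom I₀ a b d) :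
    Continuous (deriv fun t => f (linFlow ω t p)) ∧
    (∀ t, HasDerivAt (fun t => f (linFlow ω t p)) (deriv (fun t => f (linFlow ω t p)) t) t) ∧
    poisson (flowAverage ω T c f) (linHam ω) p
      = ∫ t in (0 : ℝ)..T, (c t : ℂ) * deriv (fun t => f (linFlow ω t p)) t := by
  set v := rotGen (fun j => (ω j : ℂ)) p
  have hdf : ∀ t, HasFDerivAt f (fderiv ℂ f (linFlow ω t p)) (linFlow ω t p) := fun t =>
    (hf _ (linFlow_mem_dom ω t hp)).differentiableAt.hasFDerivAt
  have hd : ∀ t, HasDerivAt (fun t => f (linFlow ω t p))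
      (fderiv ℂ f (linFlow ω t p) (linFlow ω t v)) t := fun t =>
    ((hdf t).restrictScalars ℝ).comp_hasDerivAt (f := fun t => linFlow ω t p) t (hasDerivAt_linFlow ω p t)
  have hderiv : (deriv fun t => f (linFlow ω t p))
      = fun t => fderiv ℂ f (linFlow ω t p) (linFlow ω t v) := funext fun t => (hd t).deriv
  refine ⟨?_, fun t => (hd t).differentiableAt.hasDerivAt, ?_⟩
  · rw [hderiv]
    have h1 : ∀ q : Phase n N, Continuous fun t => linFlow ω t q := fun q =>
      (continuous_linFlow ω).comp (f := fun t : ℝ => (t, q)) (by fun_prop)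
    refine Continuous.clm_apply ?_ (h1 v)
    exact hf.fderiv.continuousOn.comp_continuous (h1 p) fun t => linFlow_mem_dom ω t hp
  · rw [poisson_linHam]
    refine ((hasFDerivAt_intervalIntegral_of_holomorphic hT (isOpen_dom I₀ a b d)
      (flowAverage_continuousOn hc hf) fun t _ => ?_).2 p hp v).2.trans ?_
    · refine DifferentiableOn.const_mul ?_ _
      exact hf.differentiableOn.comp (linFlow ω t).differentiable.differentiableOn
        fun p hp => linFlow_mem_dom ω t hp
    · refine intervalIntegral.integral_congr fun t _ => ?_
      have h2 : HasFDerivAt (fun q => (c t : ℂ) * f (linFlow ω t q)) _ p :=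
        ((hdf t).comp p (linFlow ω t).hasFDerivAt).const_mul (c t : ℂ)
      simp only [h2.fderiv, hderiv]
      rfl

/-- The homological equation `{χ, ⟨ω, I⟩} = f - f̄` for a periodic flow of `⟨ω, I⟩`, with `f̄` the
average of `f` along the flow, is solved by the average of `f` with the weight `t / T - 1 / 2`. -/
theorem exists_homological_solution (hT : 0 < T)
    (hω : ∀ j, ∃ k : ℤ, T * ω j = 2 * Real.pi * k)
    (hf : RealAnalyticOn (realVectors (Fin n ⊕ Fin N)) realScalars f (dom I₀ a b d)) {ε : ℝ}
    (hε : ∀ p ∈ dom I₀ a b d, ‖f p‖ ≤ ε) :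
    ∃ f₀ χ : Phase n N → ℂ,
      RealAnalyticOn (realVectors (Fin n ⊕ Fin N)) realScalars f₀ (dom I₀ a b d) ∧
      RealAnalyticOn (realVectors (Fin n ⊕ Fin N)) realScalars χ (dom I₀ a b d) ∧
      (∀ p ∈ dom I₀ a b d, ‖f₀ p‖ ≤ ε) ∧ (∀ p ∈ dom I₀ a b d, ‖χ p‖ ≤ ε * T / 2) ∧
      (∀ p ∈ dom I₀ a b d, poisson f₀ (linHam ω) p = 0) ∧
      ∀ p ∈ dom I₀ a b d, poisson χ (linHam ω) p = f p - f₀ p := by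
  have hc₀ : Continuous fun _ : ℝ => 1 / T := continuous_const
  have hc₁ : Continuous fun t : ℝ => t / T - 1 / 2 := by fun_prop
  refine ⟨flowAverage ω T (fun _ => 1 / T) f, flowAverage ω T (fun t => t / T - 1 / 2) f,
    realAnalyticOn_flowAverage hT.le hc₀ hf, realAnalyticOn_flowAverage hT.le hc₁ hf,
    fun p hp => ?_, fun p hp => ?_, fun p hp => ?_, fun p hp => ?_⟩
  · refine (norm_flowAverage_le hT.le (C := 1 / T) (by positivity) (fun t _ => ?_) hε hp).trans_eq
      (by field_simp)
    rw [abs_of_pos (by positivity)]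
  · refine (norm_flowAverage_le hT.le (C := 1 / 2) (by norm_num) (fun t ht => ?_) hε hp).trans_eq
      (by ring)
    have h0 : 0 ≤ t / T := div_nonneg ht.1 hT.le
    have h1 : t / T ≤ 1 := (div_le_one hT).2 ht.2
    rw [abs_le]
    constructor <;> linarith
  · obtain ⟨h1, h2, h3⟩ := poisson_flowAverage (ω := ω) hT.le hc₀ hf.1 hp
    rw [h3, intervalIntegral.integral_const_mul,
      intervalIntegral.integral_eq_sub_of_hasDerivAt (fun t _ => h2 t) (h1.intervalIntegrable _ _),
      linFlow_period hω, linFlow_zero, sub_self, mul_zero]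
  · obtain ⟨h1, h2, h3⟩ := poisson_flowAverage (ω := ω) hT.le hc₁ hf.1 hp
    -- Integrate by parts: the weight takes the values `-1 / 2` and `1 / 2` at the ends of a period,
    -- so the boundary terms add up to `f p`.
    have hw : ∀ t : ℝ, HasDerivAt (fun t : ℝ => ((t / T - 1 / 2 : ℝ) : ℂ)) ((1 / T : ℝ) : ℂ) t :=
      fun t => (((hasDerivAt_id t).div_const T).sub_const (1 / 2)).ofReal_comp
    rw [h3, intervalIntegral.integral_mul_deriv_eq_deriv_mul (fun t _ => hw t) (fun t _ => h2 t)
      (continuous_const.intervalIntegrable _ _) (h1.intervalIntegrable _ _),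
      linFlow_period hω, linFlow_zero, div_self hT.ne']
    simp only [flowAverage]
    push_cast
    ring

end Averaging

/-! ### The shrinking domains -/

section Domains

variable {n N : ℕ}

lemma norm_sq_eq_zPart_add_ζPart (p : Phase n N) : ‖p‖ ^ 2 = ‖zPart p‖ ^ 2 + ‖ζPart p‖ ^ 2 := by
  rw [norm_sq_eq_sum, norm_sq_eq_sum, norm_sq_eq_sum, Fintype.sum_sum_type]
  rfl

lemma norm_zPart_le (p : Phase n N) : ‖zPart p‖ ≤ ‖p‖ :=
  (sq_le_sq₀ (norm_nonneg _) (norm_nonneg _)).1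
    (by linarith [norm_sq_eq_zPart_add_ζPart p, sq_nonneg ‖ζPart p‖])

lemma norm_ζPart_le (p : Phase n N) : ‖ζPart p‖ ≤ ‖p‖ :=
  (sq_le_sq₀ (norm_nonneg _) (norm_nonneg _)).1
    (by linarith [norm_sq_eq_zPart_add_ζPart p, sq_nonneg ‖zPart p‖])

lemma sum_norm_actions_add_sub_le (z w : Darboux (Fin n)) :
    ∑ j, ‖actions (z + w) j - actions z j‖ ≤ ‖z‖ * ‖w‖ + ‖w‖ ^ 2 / 2 := by
  have hz := norm_sq_eq_sum z
  have hw := norm_sq_eq_sum w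
  have h1 : ∀ j, ‖actions (z + w) j - actions z j‖ ≤
      (‖z (j, 0)‖ * ‖w (j, 0)‖ + ‖z (j, 1)‖ * ‖w (j, 1)‖)
        + (‖w (j, 0)‖ ^ 2 + ‖w (j, 1)‖ ^ 2) / 2 := by
    intro j
    have e : actions (z + w) j - actions z j = z (j, 0) * w (j, 0) + z (j, 1) * w (j, 1)
        + (w (j, 0) ^ 2 + w (j, 1) ^ 2) / 2 := by
      simp only [actions, PiLp.add_apply]
      ring
    rw [e]
    refine (norm_add_le _ _).trans (add_le_add ((norm_add_le _ _).trans ?_) ?_)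
    · rw [norm_mul, norm_mul]
    · rw [norm_div, Complex.norm_ofNat]
      gcongr
      refine (norm_add_le _ _).trans ?_
      rw [norm_pow, norm_pow]
  refine (Finset.sum_le_sum fun j _ => h1 j).trans ?_
  rw [Finset.sum_add_distrib, ← Finset.sum_div, ← hw]
  gcongr
  have h2 : ∑ j, (‖z (j, 0)‖ * ‖w (j, 0)‖ + ‖z (j, 1)‖ * ‖w (j, 1)‖)
      = ∑ i : Fin n × Fin 2, ‖z i‖ * ‖w i‖ := by
    rw [Fintype.sum_prod_type]
    simp
  rw [h2, EuclideanSpace.norm_eq, EuclideanSpace.norm_eq]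
  exact Real.sum_mul_le_sqrt_mul_sqrt _ _ _

variable {I₀ : Fin n → ℝ} {r₁ r₂ r₃ s τ : ℝ}

/-- A displacement of length `τ r₁ / (3 r₂)` leads from the domain of size `s` to the domain of
size `s + τ ≤ 3`. -/
lemma add_mem_dom (hr₂ : 0 < r₂) (hr₁₂ : r₁ < 2 * r₂ ^ 2)
    (hr₁₃ : r₁ < 2 * r₂ * r₃) (hτ : 0 < τ) (hs : s + τ ≤ 3) {p v : Phase n N}
    (hp : p ∈ dom I₀ (s * r₁) (s * r₂) (s * r₃)) (hv : ‖v‖ ≤ τ * r₁ / (3 * r₂)) :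
    p + v ∈ dom I₀ ((s + τ) * r₁) ((s + τ) * r₂) ((s + τ) * r₃) := by
  obtain ⟨h1, h2, h3⟩ := hp
  have hv' : 3 * r₂ * ‖v‖ ≤ τ * r₁ := by
    rw [le_div_iff₀ (by positivity)] at hv
    linarith
  have hz := norm_zPart_le v
  have hζ := norm_ζPart_le v
  have hz0 := norm_nonneg (zPart v)
  have hzp := norm_nonneg (zPart p)
  have hv2 : ‖v‖ ≤ 2 / 3 * τ * r₂ := by
    refine le_of_mul_le_mul_left (a := 3 * r₂) ?_ (by positivity)
    nlinarith
  have hv3 : ‖v‖ ≤ 2 / 3 * τ * r₃ := by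
    refine le_of_mul_le_mul_left (a := 3 * r₂) ?_ (by positivity)
    nlinarith
  have hr₃ : 0 ≤ τ * r₃ := by linarith [norm_nonneg v]
  refine ⟨?_, ?_, ?_⟩
  · have e : ∀ j, ‖actionDev I₀ (zPart (p + v)) j‖ ≤ ‖actionDev I₀ (zPart p) j‖
        + ‖actions (zPart p + zPart v) j - actions (zPart p) j‖ := by
      intro j
      refine le_trans (le_of_eq ?_) (norm_add_le _ _)
      congr 1
      change actions (zPart p + zPart v) j - _ = actions (zPart p) j - _ + _
      ring
    have h4 := (Finset.sum_le_sum (s := Finset.univ) fun j _ => e j).trans_eq Finset.sum_add_distrib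
    have h5 := sum_norm_actions_add_sub_le (zPart p) (zPart v)
    have h6 : ‖zPart p‖ * ‖zPart v‖ + ‖zPart v‖ ^ 2 / 2 ≤ 3 * r₂ * ‖v‖ := by
      have h7 : ‖zPart p‖ + ‖zPart v‖ / 2 ≤ 3 * r₂ := by nlinarith
      nlinarith
    linarith
  · refine (norm_add_le (zPart p) (zPart v)).trans_lt ?_
    nlinarith
  · refine (norm_add_le (ζPart p) (ζPart v)).trans_lt ?_
    nlinarith

lemma dom_mono {s' : ℝ} (hr₁ : 0 ≤ r₁) (hr₂ : 0 ≤ r₂) (hr₃ : 0 ≤ r₃) (h : s ≤ s') :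
    (dom I₀ (s * r₁) (s * r₂) (s * r₃) : Set (Phase n N)) ⊆
      dom I₀ (s' * r₁) (s' * r₂) (s' * r₃) := fun _ hp =>
  ⟨hp.1.trans_le (by gcongr), hp.2.1.trans_le (by gcongr), hp.2.2.trans_le (by gcongr)⟩

end Domains

/-! ### Estimates of Poisson brackets -/

section BracketEstimates

variable {n N : ℕ}

/-- The vector `(0, ζ)`. -/
noncomputable def ζTrunc (w : Phase n N) : Phase n N :=
  WithLp.toLp 2 fun i => Sum.elim (fun _ => 0) (fun j => w (Sum.inr j, i.2)) i.1

lemma norm_ζTrunc (w : Phase n N) : ‖ζTrunc w‖ = ‖ζPart w‖ := by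
  rw [← sq_eq_sq₀ (norm_nonneg _) (norm_nonneg _), norm_sq_eq_sum, norm_sq_eq_sum,
    Fintype.sum_sum_type]
  simp [ζTrunc, ζPart]

/-- The projection `(z, ζ) ↦ ζ` as a linear map. -/
noncomputable def ζCLM (n N : ℕ) : Phase n N →L[ℂ] Darboux (Fin N) :=
  LinearMap.toContinuousLinearMap
    { toFun := ζPart
      map_add' := fun _ _ => rfl
      map_smul' := fun _ _ => rfl }

lemma ζCLM_apply (p : Phase n N) : ζCLM n N p = ζPart p := rfl

variable {I₀ : Fin n → ℝ} {r₁ r₂ r₃ s τ C : ℝ} {χ : Phase n N → ℂ}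

lemma norm_fderiv_le_of_mem_dom (hr₁ : 0 < r₁) (hr₂ : 0 < r₂) (hr₁₂ : r₁ < 2 * r₂ ^ 2)
    (hr₁₃ : r₁ < 2 * r₂ * r₃) (hτ : 0 < τ) (hs : s ≤ 3)
    (hχ : AnalyticOnNhd ℂ χ (dom I₀ (s * r₁) (s * r₂) (s * r₃)))
    (hC : ∀ p ∈ dom I₀ (s * r₁) (s * r₂) (s * r₃), ‖χ p‖ ≤ C) {p : Phase n N}
    (hp : p ∈ dom I₀ ((s - τ) * r₁) ((s - τ) * r₂) ((s - τ) * r₃)) :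
    ‖fderiv ℂ χ p‖ ≤ C / (τ * r₁ / (3 * r₂)) := by
  refine norm_fderiv_le_div (isOpen_dom _ _ _ _) hχ.differentiableOn hC (by positivity)
    fun q hq => ?_
  have := add_mem_dom hr₂ hr₁₂ hr₁₃ hτ (by linarith) hp (v := q - p)
    (mem_ball_iff_norm.1 hq).le
  simpa using this

/-- Cauchy estimate along the rotations with velocities `b`. Complex rotations leave the actions
invariant, so the angle is limited only by the bound on `|z|` and the estimate does not involve the
radii; an estimate through the full differential of `χ` would carry a factor `r₂² / r₁`. -/
lemma norm_fderiv_rotGen_le (hr₂ : 0 < r₂) (hτ : 0 < τ) (hs : s ≤ 3)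
    (hχ : AnalyticOnNhd ℂ χ (dom I₀ (s * r₁) (s * r₂) (s * r₃)))
    (hC : ∀ p ∈ dom I₀ (s * r₁) (s * r₂) (s * r₃), ‖χ p‖ ≤ C) (hr₁ : 0 < r₁) (hr₃ : 0 < r₃)
    {p : Phase n N}
    (hp : p ∈ dom I₀ ((s - τ) * r₁) ((s - τ) * r₂) ((s - τ) * r₃)) {b : Fin n → ℂ} {B : ℝ}
    (hB0 : 0 ≤ B) (hB : ∀ j, ‖b j‖ ≤ B) : ‖fderiv ℂ χ p (rotGen b p)‖ ≤ C * B * (3 / τ) := by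
  rcases eq_or_lt_of_le hB0 with hB1 | hB1
  · have hb : b = 0 := funext fun j => norm_le_zero_iff.1 (hB1 ▸ hB j)
    simp [hb, rotGen_zero, ← hB1]
  · have hsτ : 0 < s - τ := by
      by_contra h
      push Not at h
      have := (norm_nonneg _).trans_lt hp.2.1
      nlinarith
    have hd : deriv (fun t : ℂ => rot (t • b) p) 0 = rotGen b p := by
      rw [(hasDerivAt_rot b p 0).deriv, zero_smul, rot_zero]
    have h := norm_fderiv_deriv_le (isOpen_dom _ _ _ _) hχ.differentiableOn hC
      (c := fun t : ℂ => rot (t • b) p) (R := τ / 3 / B) (by positivity)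
      (fun t => (hasDerivAt_rot b p t).differentiableAt) fun t ht => ?_
    · simp only [hd, zero_smul, rot_zero] at h
      refine h.trans_eq ?_
      field_simp
    -- A rotation with imaginary angles at most `τ / 3` multiplies `|z|` by at most `exp (τ / 3)`,
    -- and `exp (τ / 3) (s - τ) ≤ s` since `s ≤ 3`.
    · have him : ∀ j, |((t • b) j).im| ≤ τ / 3 := by
        intro j
        rw [lt_div_iff₀ hB1] at ht
        refine (Complex.abs_im_le_norm _).trans ?_
        rw [Pi.smul_apply, smul_eq_mul, norm_mul]
        exact (mul_le_mul_of_nonneg_left (hB j) (norm_nonneg t)).trans ht.le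
      have hmem := rot_mem_dom him hp
      have hexp : Real.exp (τ / 3) * (1 - τ / 3) ≤ 1 := by
        have h1 := Real.add_one_le_exp (-(τ / 3))
        have h2 := mul_le_mul_of_nonneg_left h1 (Real.exp_pos (τ / 3)).le
        rw [← Real.exp_add, add_neg_cancel, Real.exp_zero] at h2
        linarith
      have h3 : Real.exp (τ / 3) * (s - τ) ≤ s := by
        have h4 : s - τ ≤ (1 - τ / 3) * s := by nlinarith
        have h5 := mul_le_mul_of_nonneg_left h4 (Real.exp_pos (τ / 3)).le
        nlinarith
      exact ⟨hmem.1.trans_le (by gcongr; linarith), hmem.2.1.trans_le (by nlinarith),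
        hmem.2.2.trans_le (by gcongr; linarith)⟩

/-- Cauchy estimate in the directions of `ζ` only, for which the distance to the boundary is
`τ r₃`. -/
lemma norm_ζPart_hamField_le (hr₁ : 0 < r₁) (hr₂ : 0 < r₂) (hr₃ : 0 < r₃) (hτ : 0 < τ)
    (hχ : AnalyticOnNhd ℂ χ (dom I₀ (s * r₁) (s * r₂) (s * r₃)))
    (hC : ∀ p ∈ dom I₀ (s * r₁) (s * r₂) (s * r₃), ‖χ p‖ ≤ C) {p : Phase n N}
    (hp : p ∈ dom I₀ ((s - τ) * r₁) ((s - τ) * r₂) ((s - τ) * r₃)) :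
    ‖ζPart (hamField χ p)‖ ≤ C / (τ * r₃) := by
  set w := ζTrunc (hamField χ p) with hw
  set v := conjRotate w with hv
  have h1 : (‖w‖ : ℂ) ^ 2 = fderiv ℂ χ p v := by
    rw [← sympForm_hamField, hv, sympForm_conjRotate, Fintype.sum_sum_type]
    have h2 := norm_sq_eq_sum w
    rw [Fintype.sum_sum_type] at h2
    simp only [hw, ζTrunc, Sum.elim_inl, Sum.elim_inr, map_zero, mul_zero, add_zero,
      Finset.sum_const_zero, zero_add, Complex.mul_conj, Complex.normSq_eq_norm_sq, norm_zero,
      ne_eq, OfNat.ofNat_ne_zero, not_false_eq_true, zero_pow] at h2 ⊢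
    exact_mod_cast h2
  have hz : zPart v = 0 := by
    ext ⟨j, k⟩
    fin_cases k <;> simp [zPart, hv, conjRotate, hw, ζTrunc]
  have h3 : ‖fderiv ℂ χ p v‖ ≤ C / (τ * r₃) * ‖v‖ := by
    refine norm_fderiv_apply_le_mul (isOpen_dom _ _ _ _) hχ.differentiableOn hC (by positivity)
      fun t ht => ?_
    have hz' : zPart (p + t • v) = zPart p := by
      have : zPart (p + t • v) = zPart p + t • zPart v := rfl
      rw [this, hz, smul_zero, add_zero]
    refine ⟨?_, ?_, ?_⟩
    · rw [hz']
      exact hp.1.trans_le (by gcongr; linarith)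
    · rw [hz']
      exact hp.2.1.trans_le (by gcongr; linarith)
    · have h4 : ‖ζPart (t • v)‖ ≤ ‖t • v‖ := norm_ζPart_le _
      have h5 : ζPart (p + t • v) = ζPart p + ζPart (t • v) := rfl
      rw [h5]
      have h6 := hp.2.2
      refine (norm_add_le _ _).trans_lt ?_
      nlinarith
  rw [← h1, hv, norm_conjRotate, norm_pow, Complex.norm_real, norm_norm] at h3
  rw [← norm_ζTrunc, ← hw]
  rcases eq_or_lt_of_le (norm_nonneg w) with h0 | h0
  · have := (norm_nonneg _).trans (hC p (dom_mono hr₁.le hr₂.le hr₃.le (by linarith) hp))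
    rw [← h0]
    positivity
  · exact le_of_mul_le_mul_right (by linarith [sq ‖w‖]) h0

end BracketEstimates

/-! ### Real analytic functions and symplectic transformations -/

section RealAnalytic

lemma mem_realScalars_iff {w : ℂ} : w ∈ realScalars ↔ w ∈ Complex.ofRealHom.range := by
  refine ⟨fun h => ⟨w.re, Complex.ext (by simp) (by simpa using h.symm)⟩, ?_⟩
  rintro ⟨x, rfl⟩
  simp [realScalars]

variable {E F : Type*} [NormedAddCommGroup E] [NormedSpace ℂ E] [NormedAddCommGroup F]
  [NormedSpace ℂ F] {RE : Set E} {U V : Set E}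

lemma RealAnalyticOn.mono {RF : Set F} {f : E → F} (hf : RealAnalyticOn RE RF f U) (h : V ⊆ U) :
    RealAnalyticOn RE RF f V :=
  ⟨hf.1.mono h, hf.2.mono_left (Set.inter_subset_inter_left _ h)⟩

lemma RealAnalyticOn.comp {G : Type*} [NormedAddCommGroup G] [NormedSpace ℂ G] {RF : Set F}
    {RG : Set G} {f : F → G} {g : E → F} {V : Set F} (hf : RealAnalyticOn RF RG f V)
    (hg : RealAnalyticOn RE RF g U) (h : Set.MapsTo g U V) :
    RealAnalyticOn RE RG (fun x => f (g x)) U :=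
  ⟨hf.1.comp hg.1 h, fun _ hx => hf.2 ⟨h hx.1, hg.2 hx⟩⟩

lemma RealAnalyticOn.add {f g : E → ℂ} (hf : RealAnalyticOn RE realScalars f U)
    (hg : RealAnalyticOn RE realScalars g U) :
    RealAnalyticOn RE realScalars (fun x => f x + g x) U :=
  ⟨hf.1.add hg.1, fun _ hx => mem_realScalars_iff.2
    (add_mem (mem_realScalars_iff.1 (hf.2 hx)) (mem_realScalars_iff.1 (hg.2 hx)))⟩

lemma RealAnalyticOn.sub {f g : E → ℂ} (hf : RealAnalyticOn RE realScalars f U)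
    (hg : RealAnalyticOn RE realScalars g U) :
    RealAnalyticOn RE realScalars (fun x => f x - g x) U :=
  ⟨hf.1.sub hg.1, fun _ hx => mem_realScalars_iff.2
    (sub_mem (mem_realScalars_iff.1 (hf.2 hx)) (mem_realScalars_iff.1 (hg.2 hx)))⟩

lemma RealAnalyticOn.const_mul {f : E → ℂ} (hf : RealAnalyticOn RE realScalars f U) (c : ℝ) :
    RealAnalyticOn RE realScalars (fun x => (c : ℂ) * f x) U :=
  ⟨analyticOnNhd_const.mul hf.1, fun _ hx => mem_realScalars_iff.2
    (mul_mem ⟨c, rfl⟩ (mem_realScalars_iff.1 (hf.2 hx)))⟩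

variable {n N : ℕ}

lemma actions_mem_range {p : Phase n N} (hp : p ∈ realVectors (Fin n ⊕ Fin N)) (j : Fin n) :
    actions (zPart p) j ∈ Complex.ofRealHom.range := by
  have h : ∀ k, p (Sum.inl j, k) ∈ Complex.ofRealHom.range := fun k =>
    mem_realScalars_iff.1 (hp (Sum.inl j, k))
  have h2 : actions (zPart p) j
      = ((2⁻¹ : ℝ) : ℂ) * (p (Sum.inl j, 0) ^ 2 + p (Sum.inl j, 1) ^ 2) := by
    simp only [actions, zPart]
    push_cast
    ring
  rw [h2]
  exact mul_mem ⟨2⁻¹, rfl⟩ (add_mem (pow_mem (h 0) 2) (pow_mem (h 1) 2))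

lemma realAnalyticOn_linHam (ω₀ : Fin n → ℝ) (U : Set (Phase n N)) :
    RealAnalyticOn (realVectors (Fin n ⊕ Fin N)) realScalars (linHam ω₀) U := by
  refine ⟨(DifferentiableOn.analyticOnNhd_of_finiteDimensional isOpen_univ fun p _ =>
    (hasFDerivAt_actionForm _ p).differentiableAt.differentiableWithinAt).mono
      (Set.subset_univ U), fun p hp => ?_⟩
  exact mem_realScalars_iff.2 (sum_mem fun j _ =>
    mul_mem ⟨ω₀ j, rfl⟩ (actions_mem_range hp.2 j))

lemma realAnalyticOn_quadHam (I₀ : Fin n → ℝ) {A : Matrix (Fin n) (Fin n) ℝ} (hA : A.IsSymm)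
    (U : Set (Phase n N)) :
    RealAnalyticOn (realVectors (Fin n ⊕ Fin N)) realScalars (quadHam I₀ A) U := by
  refine ⟨(DifferentiableOn.analyticOnNhd_of_finiteDimensional isOpen_univ fun p _ =>
    (hasFDerivAt_quadHam I₀ hA p).differentiableAt.differentiableWithinAt).mono
      (Set.subset_univ U), fun p hp => ?_⟩
  have hdev : ∀ j, actionDev I₀ (zPart p) j ∈ Complex.ofRealHom.range := fun j =>
    sub_mem (actions_mem_range hp.2 j) ⟨I₀ j, rfl⟩
  refine mem_realScalars_iff.2 (mul_mem ⟨1 / 2, by simp⟩ (sum_mem fun i _ => sum_mem fun j _ =>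
    mul_mem (mul_mem ⟨A i j, rfl⟩ (hdev j)) (hdev i)))

lemma realAnalyticOn_comp_ζPart {Λ : Darboux (Fin N) → ℂ} {R : ℝ} {U : Set (Phase n N)}
    (hΛ : RealAnalyticNear (realVectors (Fin N)) realScalars Λ {ζ | ‖ζ‖ ≤ R})
    (hU : ∀ p ∈ U, ‖ζPart p‖ ≤ R) :
    RealAnalyticOn (realVectors (Fin n ⊕ Fin N)) realScalars (fun p => Λ (ζPart p)) U := by
  obtain ⟨V, -, hV, hΛ⟩ := hΛ
  refine hΛ.comp (g := ζPart) ⟨fun p _ => (ζCLM n N).analyticAt p, fun p hp i => hp.2 _⟩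
    fun p hp => hV (hU p hp)

lemma realAnalyticOn_hamiltonian {ω₀ I₀ : Fin n → ℝ} {A : Matrix (Fin n) (Fin n) ℝ}
    (hA : A.IsSymm) (κ : ℝ) {Λ : Darboux (Fin N) → ℂ} {R : ℝ} {U : Set (Phase n N)}
    (hΛ : RealAnalyticNear (realVectors (Fin N)) realScalars Λ {ζ | ‖ζ‖ ≤ R})
    (hU : ∀ p ∈ U, ‖ζPart p‖ ≤ R) {g f : Phase n N → ℂ}
    (hg : RealAnalyticOn (realVectors (Fin n ⊕ Fin N)) realScalars g U)
    (hf : RealAnalyticOn (realVectors (Fin n ⊕ Fin N)) realScalars f U) :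
    RealAnalyticOn (realVectors (Fin n ⊕ Fin N)) realScalars (hamiltonian ω₀ I₀ A κ Λ g f) U :=
  ((((realAnalyticOn_linHam ω₀ U).add (realAnalyticOn_quadHam I₀ hA U)).add hg).add hf).add
    ((realAnalyticOn_comp_ζPart hΛ hU).const_mul κ)

end RealAnalytic

section Symplectic

variable {ι : Type} [Fintype ι]

lemma isSymplecticTransformation_id (S : Set (Darboux ι)) :
    IsSymplecticTransformation (fun p => p) S :=
  ⟨⟨analyticOnNhd_id, fun _ hp => hp.2⟩, Function.injective_id.injOn, fun p _ u v => by simp⟩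

lemma IsSymplecticTransformation.comp {Ψ Φ : Darboux ι → Darboux ι} {S S' : Set (Darboux ι)}
    (hΨ : IsSymplecticTransformation Ψ S) (hΦ : IsSymplecticTransformation Φ S')
    (h : Set.MapsTo Φ S' S) : IsSymplecticTransformation (fun p => Ψ (Φ p)) S' := by
  refine ⟨hΨ.realAnalytic.comp hΦ.realAnalytic h, hΨ.injOn.comp hΦ.injOn h, fun p hp u v => ?_⟩
  have h1 : HasFDerivAt (fun p => Ψ (Φ p)) _ p :=
    (hΨ.realAnalytic.1 _ (h hp)).differentiableAt.hasFDerivAt.comp p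
      (hΦ.realAnalytic.1 p hp).differentiableAt.hasFDerivAt
  rw [h1.fderiv, ContinuousLinearMap.comp_apply, ContinuousLinearMap.comp_apply,
    hΨ.symplectic _ (h hp), hΦ.symplectic p hp]

lemma IsSymplecticTransformation.mono {Ψ : Darboux ι → Darboux ι} {S S' : Set (Darboux ι)}
    (hΨ : IsSymplecticTransformation Ψ S) (h : S' ⊆ S) : IsSymplecticTransformation Ψ S' :=
  ⟨hΨ.realAnalytic.mono h, hΨ.injOn.mono h, fun p hp => hΨ.symplectic p (h hp)⟩

end Symplectic

/-! ### The averaging step and its iteration -/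

section NormalForm

variable {n N : ℕ}

/-- One step of the averaging procedure, from the domain of size `s` to that of size `s - σ`: the
time-one flow of the solution `χ` of the homological equation moves the average `f₀` of `f` into the
integrable part, and leaves a perturbation of at most half the size. -/
theorem exists_averaging_step {ω₀ I₀ : Fin n → ℝ} {A : Matrix (Fin n) (Fin n) ℝ} (hA : A.IsSymm)
    {T κ : ℝ} (hT : 0 < T) (hκ : 0 < κ) (hω : ∀ j, ∃ k : ℤ, T * ω₀ j = 2 * Real.pi * k)
    {r₁ r₂ r₃ : ℝ} (hr₁ : 0 < r₁) (hr₂ : 0 < r₂) (hr₃ : 0 < r₃) (hr₁₂ : r₁ < 2 * r₂ ^ 2)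
    (hr₁₃ : r₁ < 2 * r₂ * r₃) {CΛ : ℝ} (hCΛ : 0 < CΛ) {Λ : Darboux (Fin N) → ℂ}
    (hΛ : RealAnalyticNear (realVectors (Fin N)) realScalars Λ {ζ | ‖ζ‖ ≤ 3 * r₃})
    (hDΛ : ∀ ζ : Darboux (Fin N), ‖ζ‖ ≤ 3 * r₃ → ‖fderiv ℂ Λ ζ‖ ≤ CΛ * ‖ζ‖)
    {s σ : ℝ} (hσ : 0 < σ) (hs : s ≤ 3) {g f : Phase n N → ℂ} {δ ε : ℝ} (hε : 0 < ε)
    (hg : RealAnalyticOn (realVectors (Fin n ⊕ Fin N)) realScalars g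
      (dom I₀ (s * r₁) (s * r₂) (s * r₃)))
    (hf : RealAnalyticOn (realVectors (Fin n ⊕ Fin N)) realScalars f
      (dom I₀ (s * r₁) (s * r₂) (s * r₃)))
    (hgδ : ∀ p ∈ dom I₀ (s * r₁) (s * r₂) (s * r₃), ‖g p‖ ≤ δ)
    (hfε : ∀ p ∈ dom I₀ (s * r₁) (s * r₂) (s * r₃), ‖f p‖ ≤ ε)
    (hm : ε * T < (σ * r₁ / (9 * r₂)) ^ 2)
    (hsmall : 27 / 2 * l1OpNorm A * r₁ * T / σ
      + 81 / 2 * (δ + ε) * r₂ ^ 2 * T / (σ ^ 2 * r₁ ^ 2)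
      + 9 / 2 * κ * CΛ * T / σ ≤ 1 / 2) :
    ∃ (Φ : Phase n N → Phase n N) (f₀ f' : Phase n N → ℂ),
      IsSymplecticTransformation Φ (dom I₀ ((s - σ) * r₁) ((s - σ) * r₂) ((s - σ) * r₃)) ∧
      Set.MapsTo Φ (dom I₀ ((s - σ) * r₁) ((s - σ) * r₂) ((s - σ) * r₃))
        (dom I₀ (s * r₁) (s * r₂) (s * r₃)) ∧
      RealAnalyticOn (realVectors (Fin n ⊕ Fin N)) realScalars f₀
        (dom I₀ (s * r₁) (s * r₂) (s * r₃)) ∧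
      RealAnalyticOn (realVectors (Fin n ⊕ Fin N)) realScalars f'
        (dom I₀ ((s - σ) * r₁) ((s - σ) * r₂) ((s - σ) * r₃)) ∧
      (∀ p ∈ dom I₀ ((s - σ) * r₁) ((s - σ) * r₂) ((s - σ) * r₃),
        hamiltonian ω₀ I₀ A κ Λ g f (Φ p)
          = hamiltonian ω₀ I₀ A κ Λ (fun q => g q + f₀ q) f' p) ∧
      (∀ p ∈ dom I₀ ((s - σ) * r₁) ((s - σ) * r₂) ((s - σ) * r₃),
        ‖Φ p - p‖ ≤ 9 * r₂ / (2 * σ * r₁) * ε * T) ∧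
      (∀ p ∈ dom I₀ (s * r₁) (s * r₂) (s * r₃), ‖f₀ p‖ ≤ ε) ∧
      (∀ p ∈ dom I₀ (s * r₁) (s * r₂) (s * r₃), poisson f₀ (linHam ω₀) p = 0) ∧
      ∀ p ∈ dom I₀ ((s - σ) * r₁) ((s - σ) * r₂) ((s - σ) * r₃), ‖f' p‖ ≤ ε / 2 := by
  -- The differential of `χ` is estimated on `U`, at the loss `τ`; the remaining loss `2 τ` keeps the
  -- flow that starts in `W` inside `U`.
  set τ := σ / 3 with hτdef
  have hτ : 0 < τ := by positivity
  have hτσ : s - τ ≤ s := by linarith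
  set D := (dom I₀ (s * r₁) (s * r₂) (s * r₃) : Set (Phase n N)) with hD
  set U := (dom I₀ ((s - τ) * r₁) ((s - τ) * r₂) ((s - τ) * r₃) : Set (Phase n N)) with hU
  set W := (dom I₀ ((s - σ) * r₁) ((s - σ) * r₂) ((s - σ) * r₃) : Set (Phase n N)) with hW
  have hDo : IsOpen D := isOpen_dom _ _ _ _
  have hUD : U ⊆ D := dom_mono hr₁.le hr₂.le hr₃.le hτσ
  have hWD : W ⊆ D := dom_mono hr₁.le hr₂.le hr₃.le (by linarith)
  obtain ⟨f₀, χ, hf₀, hχ, hf₀ε, hχε, hf₀h, hχh⟩ := exists_homological_solution hT hω hf hfε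
  set c := ε * T / 2 with hc
  have hc0 : 0 < c := by positivity
  set d := τ * r₁ / (3 * r₂) with hd
  have hd0 : 0 < d := by positivity
  have hcd : 2 * c < d ^ 2 := by
    have : d = σ * r₁ / (9 * r₂) := by
      rw [hd, hτdef]
      field_simp
      norm_num
    rw [this, hc]
    linarith
  have hX : ∀ q ∈ U, ‖hamField χ q‖ ≤ c / d := fun q hq =>
    (norm_hamField_le χ q).trans
      (norm_fderiv_le_of_mem_dom hr₁ hr₂ hr₁₂ hr₁₃ hτ hs hχ.1 hχε hq)
  have hslow : IsSlowField (hamField χ) U W (c / d) (2 * d) := by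
    refine ⟨isOpen_dom _ _ _ _, isOpen_dom _ _ _ _,
      differentiableOn_hamField (hχ.1.mono hUD), hX, fun p hp q hq => ?_, by positivity, ?_⟩
    · have hq' : ‖q - p‖ ≤ 2 * τ * r₁ / (3 * r₂) := by
        refine (mem_ball_iff_norm.1 hq).le.trans_eq ?_
        rw [hd]
        ring
      have := add_mem_dom hr₂ hr₁₂ hr₁₃ (by positivity) (by linarith) hp hq'
      rw [add_sub_cancel, show s - σ + 2 * τ = s - τ by rw [hτdef]; ring] at this
      exact this
    · rw [← mul_div_assoc, div_lt_iff₀ hd0]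
      nlinarith
  obtain ⟨Φ, hΦ, hsymp⟩ := hslow.exists_symplectic_flow (hχ.mono hUD)
  have hζ : ∀ p ∈ D, ‖ζPart p‖ ≤ 3 * r₃ := fun p hp => hp.2.2.le.trans (by gcongr)
  have hmaps : Set.MapsTo (Φ 1) W D := fun p hp => hUD (hΦ.mem_domain hslow (by simp) hp)
  have hRA : RealAnalyticOn (realVectors (Fin n ⊕ Fin N)) realScalars
      (fun p => hamiltonian ω₀ I₀ A κ Λ g f (Φ 1 p) - hamiltonian ω₀ I₀ A κ Λ g f₀ p) W :=
    ((realAnalyticOn_hamiltonian hA κ hΛ hζ hg hf).comp hsymp.realAnalytic hmaps).sub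
      (realAnalyticOn_hamiltonian hA κ hΛ (fun p hp => hζ p (hWD hp)) (hg.mono hWD)
        (hf₀.mono hWD))
  refine ⟨Φ 1, f₀, _, hsymp, hmaps, hf₀, hRA, fun p hp => ?_, fun p hp => ?_, hf₀ε, hf₀h,
    fun p hp => ?_⟩
  · simp only [hamiltonian]
    ring
  · refine (hΦ.norm_sub_le 1 (by simp) p hp).trans_eq ?_
    rw [hc, hd, hτdef]
    field_simp
    norm_num
  -- The new perturbation is the increment over `[0, 1]` of `t ↦ B_t (Φ^t p)`, where `B_t` runs
  -- from the averaged Hamiltonian to the original one.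
  have hder : ∀ t ∈ Set.Icc (0 : ℝ) 1, ∃ y : ℂ, ‖y‖ ≤ ε / 2 ∧ HasDerivWithinAt
      (fun t : ℝ => hamiltonian ω₀ I₀ A κ Λ g f₀ (Φ t p) + (t : ℂ) * (f (Φ t p) - f₀ (Φ t p)))
      y (Set.Icc 0 1) t := by
    intro t ht
    set q := Φ t p with hq
    have hqU : q ∈ U := hΦ.mem_domain hslow ht hp
    have hqD := hUD hqU
    set X := hamField χ q with hXdef
    have dg := (hg.1 q hqD).differentiableAt
    have df := (hf.1 q hqD).differentiableAt
    have df₀ := (hf₀.1 q hqD).differentiableAt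
    have dΛ : DifferentiableAt ℂ Λ (ζPart q) := by
      obtain ⟨V, -, hV, hΛ'⟩ := hΛ
      exact (hΛ'.1 _ (hV (hζ q hqD))).differentiableAt
    have hK0 : HasFDerivAt (hamiltonian ω₀ I₀ A κ Λ g f₀)
        (fderiv ℂ (linHam ω₀) q + fderiv ℂ (quadHam I₀ A) q + fderiv ℂ g q + fderiv ℂ f₀ q
          + (κ : ℂ) • (fderiv ℂ Λ (ζPart q)).comp (ζCLM n N)) q := by
      have h1 : HasFDerivAt (linHam ω₀) (fderiv ℂ (linHam ω₀) q) q :=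
        (hasFDerivAt_actionForm _ q).differentiableAt.hasFDerivAt
      have h2 := (hasFDerivAt_quadHam I₀ hA q).differentiableAt.hasFDerivAt
      have h3 : HasFDerivAt (fun q : Phase n N => Λ (ζPart q))
          ((fderiv ℂ Λ (ζPart q)).comp (ζCLM n N)) q :=
        HasFDerivAt.comp (f := ζPart) q dΛ.hasFDerivAt (ζCLM n N).hasFDerivAt
      exact (((h1.add h2).add dg.hasFDerivAt).add df₀.hasFDerivAt).add (h3.const_mul (κ : ℂ))
    have hF : HasFDerivAt (fun q => g q + ((1 - t : ℂ) * f₀ q + (t : ℂ) * f q))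
        (fderiv ℂ g q + ((1 - t : ℂ) • fderiv ℂ f₀ q + (t : ℂ) • fderiv ℂ f q)) q :=
      dg.hasFDerivAt.add ((df₀.hasFDerivAt.const_mul _).add (df.hasFDerivAt.const_mul _))
    have e1 := hΦ.hasDerivWithinAt_comp hslow hp ht hK0.differentiableAt
    have e2 := hΦ.hasDerivWithinAt_comp hslow hp ht (df.sub df₀)
    have e3 : HasDerivWithinAt (fun t : ℝ => (t : ℂ)) 1 (Set.Icc 0 1) t :=
      Complex.ofRealCLM.hasDerivAt.hasDerivWithinAt
    -- The homological equation cancels the part of order `ε` in the derivative of `B_t (Φ^t p)`.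
    have hh : fderiv ℂ (linHam ω₀) q X = -(f q - f₀ q) := by
      rw [hXdef, ← poisson_eq_fderiv, poisson_swap, hχh q hqD]
    have hQ : ‖fderiv ℂ (quadHam I₀ A) q X‖ ≤ c * (l1OpNorm A * (3 * r₁)) * (3 / τ) := by
      rw [hXdef, ← poisson_eq_fderiv, poisson_quadHam I₀ hA, norm_neg]
      have hA0 : 0 ≤ l1OpNorm A := norm_nonneg _
      refine norm_fderiv_rotGen_le hr₂ hτ hs hχ.1 hχε hr₁ hr₃ hqU (by positivity) fun j => ?_
      refine (norm_quadFreq_le I₀ A q j).trans ?_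
      gcongr
      exact hqD.1.le.trans (by gcongr)
    have hGF : ‖fderiv ℂ (fun q => g q + ((1 - t : ℂ) * f₀ q + (t : ℂ) * f q)) q X‖
        ≤ (δ + ε) / d * (c / d) := by
      have hFa : AnalyticOnNhd ℂ (fun q => g q + ((1 - t : ℂ) * f₀ q + (t : ℂ) * f q)) D :=
        hg.1.add ((analyticOnNhd_const.mul hf₀.1).add (analyticOnNhd_const.mul hf.1))
      have hFb : ∀ q ∈ D, ‖g q + ((1 - t : ℂ) * f₀ q + (t : ℂ) * f q)‖ ≤ δ + ε := by
        intro q hq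
        refine (norm_add_le _ _).trans (add_le_add (hgδ q hq) ((norm_add_le _ _).trans ?_))
        have n1 : ‖(1 - t : ℂ)‖ = 1 - t := by
          rw [← Complex.ofReal_one, ← Complex.ofReal_sub, Complex.norm_real,
            Real.norm_of_nonneg (by linarith [ht.2])]
        have n2 : ‖(t : ℂ)‖ = t := by
          rw [Complex.norm_real, Real.norm_of_nonneg ht.1]
        rw [norm_mul, norm_mul, n1, n2]
        have h1 := mul_le_mul_of_nonneg_left (hf₀ε q hq) (sub_nonneg.2 ht.2)
        have h2 := mul_le_mul_of_nonneg_left (hfε q hq) ht.1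
        linarith
      have h1 := norm_fderiv_le_of_mem_dom hr₁ hr₂ hr₁₂ hr₁₃ hτ hs hFa hFb hqU
      exact (ContinuousLinearMap.le_opNorm _ _).trans (mul_le_mul h1 (hX q hqU) (norm_nonneg _)
        ((norm_nonneg _).trans h1))
    have hLam : ‖fderiv ℂ Λ (ζPart q) (ζPart X)‖ ≤ CΛ * (3 * r₃) * (c / (τ * r₃)) := by
      have h1 : ‖fderiv ℂ Λ (ζPart q)‖ ≤ CΛ * (3 * r₃) :=
        (hDΛ _ (hζ q hqD)).trans (by gcongr; exact hζ q hqD)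
      exact (ContinuousLinearMap.le_opNorm _ _).trans (mul_le_mul h1
        (norm_ζPart_hamField_le hr₁ hr₂ hr₃ hτ hχ.1 hχε hqU) (norm_nonneg _) (by positivity))
    refine ⟨fderiv ℂ (quadHam I₀ A) q X
      + fderiv ℂ (fun q => g q + ((1 - t : ℂ) * f₀ q + (t : ℂ) * f q)) q X
      + (κ : ℂ) * fderiv ℂ Λ (ζPart q) (ζPart X), ?_, ?_⟩
    · have hsum : c * (l1OpNorm A * (3 * r₁)) * (3 / τ) + (δ + ε) / d * (c / d)
          + κ * (CΛ * (3 * r₃) * (c / (τ * r₃))) ≤ ε / 2 := by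
        have e : c * (l1OpNorm A * (3 * r₁)) * (3 / τ) + (δ + ε) / d * (c / d)
            + κ * (CΛ * (3 * r₃) * (c / (τ * r₃))) = ε * (27 / 2 * l1OpNorm A * r₁ * T / σ
            + 81 / 2 * (δ + ε) * r₂ ^ 2 * T / (σ ^ 2 * r₁ ^ 2) + 9 / 2 * κ * CΛ * T / σ) := by
          rw [hc, hd, hτdef]
          field_simp
          ring
        rw [e]
        nlinarith
      refine (norm_add₃_le).trans (le_trans (add_le_add (add_le_add hQ hGF) ?_) hsum)
      rw [norm_mul, Complex.norm_real, Real.norm_of_nonneg hκ.le]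
      gcongr
    · refine (e1.add (e3.mul e2)).congr_deriv ?_
      rw [poisson_eq_fderiv, poisson_eq_fderiv, hK0.fderiv,
        (df.hasFDerivAt.sub df₀.hasFDerivAt).fderiv, hF.fderiv, ← hXdef]
      simp only [add_apply, sub_apply, smul_apply, ContinuousLinearMap.comp_apply, smul_eq_mul,
        ζCLM_apply, hh, Pi.sub_apply, ← hq]
      ring
  choose! y hy hy' using hder
  have h01 := norm_image_sub_le_of_norm_deriv_le_segment_01' hy'
    fun t ht => hy t (Set.Ico_subset_Icc_self ht)
  refine le_trans (le_of_eq ?_) h01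
  congr 1
  simp only [hΦ.apply_zero hp, hamiltonian]
  push_cast
  ring

end NormalForm

theorem lemma4p1 (n N m : ℕ)
    (ω₀ I₀ : Fin n → ℝ) (A : Matrix (Fin n) (Fin n) ℝ) (hA : A.IsSymm)
    (T κ : ℝ) (hT : 0 < T) (hκ : 0 < κ)
    (hω : ∀ j, ∃ k : ℤ, T * ω₀ j = 2 * Real.pi * k)
    (r₁ r₂ r₃ : ℝ) (hr₁ : 0 < r₁) (hr₂ : 0 < r₂) (hr₃ : 0 < r₃)
    (δ ε CΛ : ℝ) (hδ : 0 < δ) (hε : 0 < ε) (hCΛ : 0 < CΛ)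
    (g f : Phase n N → ℂ) (Λ : Darboux (Fin N) → ℂ)
    (hg : RealAnalyticNear (realVectors (Fin n ⊕ Fin N)) realScalars g
      (closure (dom I₀ (3 * r₁) (3 * r₂) (3 * r₃))))
    (hf : RealAnalyticNear (realVectors (Fin n ⊕ Fin N)) realScalars f
      (closure (dom I₀ (3 * r₁) (3 * r₂) (3 * r₃))))
    (hΛ : RealAnalyticNear (realVectors (Fin N)) realScalars Λ {ζ | ‖ζ‖ ≤ 3 * r₃})
    (hgδ : SupNormLE g (dom I₀ (3 * r₁) (3 * r₂) (3 * r₃)) δ)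
    (hgh : ∀ p ∈ dom I₀ (3 * r₁) (3 * r₂) (3 * r₃), poisson g (linHam ω₀) p = 0)
    (hfε : SupNormLE f (dom I₀ (3 * r₁) (3 * r₂) (3 * r₃)) ε)
    (hDΛ : ∀ ζ : Darboux (Fin N), ‖ζ‖ ≤ 3 * r₃ → ‖fderiv ℂ Λ ζ‖ ≤ CΛ * ‖ζ‖)
    (hr₁₂ : r₁ < 2 * r₂ ^ 2) (hr₁₃ : r₁ < 2 * r₂ * r₃)
    (hm : (m : ℝ) ^ 2 * ε * T < r₁ ^ 2 / (81 * r₂ ^ 2))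
    (hsmall : 54 * m * l1OpNorm A * r₁ * T
      + 324 * (δ + 2 * ε) * (m : ℝ) ^ 2 * r₂ ^ 2 * T / r₁ ^ 2
      + 9 * κ * CΛ * m * T / 2 ≤ 1 / 2) :
    ∃ (Ψ : Phase n N → Phase n N) (g' f' : Phase n N → ℂ),
      IsSymplecticTransformation Ψ (dom I₀ (2 * r₁) (2 * r₂) (2 * r₃)) ∧
      Set.MapsTo Ψ (dom I₀ (2 * r₁) (2 * r₂) (2 * r₃)) (dom I₀ (3 * r₁) (3 * r₂) (3 * r₃)) ∧
      RealAnalyticOn (realVectors (Fin n ⊕ Fin N)) realScalars g' (dom I₀ (2 * r₁) (2 * r₂) (2 * r₃)) ∧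
      RealAnalyticOn (realVectors (Fin n ⊕ Fin N)) realScalars f' (dom I₀ (2 * r₁) (2 * r₂) (2 * r₃)) ∧
      (∀ p ∈ dom I₀ (2 * r₁) (2 * r₂) (2 * r₃),
        hamiltonian ω₀ I₀ A κ Λ g f (Ψ p) = hamiltonian ω₀ I₀ A κ Λ g' f' p) ∧
      SupNormLE (fun p => Ψ p - p) (dom I₀ (2 * r₁) (2 * r₂) (2 * r₃))
        (18 * m * r₂ / r₁ * ε * T) ∧
      SupNormLE g' (dom I₀ (2 * r₁) (2 * r₂) (2 * r₃)) (δ + 2 * ε) ∧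
      (∀ p ∈ dom I₀ (2 * r₁) (2 * r₂) (2 * r₃), poisson g' (linHam ω₀) p = 0) ∧
      SupNormLE f' (dom I₀ (2 * r₁) (2 * r₂) (2 * r₃)) ((2 : ℝ)⁻¹ ^ m * ε) := by

  obtain ⟨Ug, -, hUg, hg⟩ := hg
  obtain ⟨Uf, -, hUf, hf⟩ := hf
  replace hg := hg.mono (subset_closure.trans hUg)
  replace hf := hf.mono (subset_closure.trans hUf)
  -- For `m = 0` the junk value `m⁻¹ = 0` is harmless: only `k = 0` occurs, with domain `D_{3r}`.
  have key : ∀ k : ℕ, k ≤ m → ∃ (Ψ : Phase n N → Phase n N) (g' f' : Phase n N → ℂ),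
      ∀ D, D = dom I₀ ((3 - k * (m : ℝ)⁻¹) * r₁) ((3 - k * (m : ℝ)⁻¹) * r₂)
        ((3 - k * (m : ℝ)⁻¹) * r₃) →
      IsSymplecticTransformation Ψ D ∧
      Set.MapsTo Ψ D (dom I₀ (3 * r₁) (3 * r₂) (3 * r₃)) ∧
      RealAnalyticOn (realVectors (Fin n ⊕ Fin N)) realScalars g' D ∧
      RealAnalyticOn (realVectors (Fin n ⊕ Fin N)) realScalars f' D ∧
      (∀ p ∈ D, hamiltonian ω₀ I₀ A κ Λ g f (Ψ p) = hamiltonian ω₀ I₀ A κ Λ g' f' p) ∧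
      (∀ p ∈ D, ‖Ψ p - p‖ ≤ 18 * m * r₂ / r₁ * ε * T * (1 - (2 : ℝ)⁻¹ ^ k)) ∧
      (∀ p ∈ D, ‖g' p‖ ≤ δ + 2 * ε * (1 - (2 : ℝ)⁻¹ ^ k)) ∧
      (∀ p ∈ D, poisson g' (linHam ω₀) p = 0) ∧
      ∀ p ∈ D, ‖f' p‖ ≤ (2 : ℝ)⁻¹ ^ k * ε := by
    intro k
    induction k with
    | zero =>
      refine fun _ => ⟨fun p => p, g, f, ?_⟩
      rintro D hD
      obtain rfl : D = dom I₀ (3 * r₁) (3 * r₂) (3 * r₃) := by simpa using hD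
      exact ⟨isSymplecticTransformation_id _, fun p hp => hp, hg, hf, fun p _ => rfl,
        fun p _ => by simp, fun p hp => by simpa using hgδ p hp, hgh,
        fun p hp => by simpa using hfε p hp⟩
    | succ k ih =>
      intro hk
      obtain ⟨Ψ, g₁, f₁, h⟩ := ih (by omega)
      obtain ⟨hΨ, hmaps, hg₁, hf₁, hid, hdisp, hg₁δ, hg₁h, hf₁ε⟩ := h _ rfl
      have hm0 : (0 : ℝ) < m := by
        have : 0 < m := by omega
        exact_mod_cast this
      set s : ℝ := 3 - k * (m : ℝ)⁻¹ with hs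
      set e : ℝ := (2 : ℝ)⁻¹ ^ k with he
      have he0 : 0 < e := by positivity
      have he1 : e ≤ 1 := pow_le_one₀ (by norm_num) (by norm_num)
      have heε : e * ε ≤ ε := by nlinarith
      have hs3 : s ≤ 3 := by
        rw [hs]
        have : 0 ≤ k * (m : ℝ)⁻¹ := by positivity
        linarith
      obtain ⟨Φ, f₀, f₂, hΦ, hΦmaps, hf₀, hf₂, hΦid, hΦdisp, hf₀ε, hf₀h, hf₂ε⟩ :=
        exists_averaging_step (s := s) (σ := (m : ℝ)⁻¹) (ε := e * ε) hA hT hκ hω hr₁ hr₂ hr₃ hr₁₂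
          hr₁₃ hCΛ hΛ hDΛ (by positivity) hs3 (by positivity) hg₁ hf₁ hg₁δ hf₁ε
          (by
            have h1 : ((m : ℝ)⁻¹ * r₁ / (9 * r₂)) ^ 2 = r₁ ^ 2 / (81 * r₂ ^ 2) / m ^ 2 := by
              field_simp
              norm_num
            rw [h1, lt_div_iff₀ (by positivity)]
            refine lt_of_le_of_lt ?_ hm
            calc e * ε * T * (m : ℝ) ^ 2 ≤ ε * T * (m : ℝ) ^ 2 := by gcongr
              _ = (m : ℝ) ^ 2 * ε * T := by ring)
          (by
            have h1 : δ + 2 * ε * (1 - e) + e * ε ≤ δ + 2 * ε := by nlinarith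
            have hA0 : 0 ≤ l1OpNorm A := norm_nonneg _
            refine le_trans ?_ hsmall
            have a1 : 27 / 2 * l1OpNorm A * r₁ * T / (m : ℝ)⁻¹ ≤ 54 * m * l1OpNorm A * r₁ * T := by
              rw [div_inv_eq_mul]
              have : 0 ≤ l1OpNorm A * r₁ * T * m := by positivity
              linarith
            have a2 : 81 / 2 * (δ + 2 * ε * (1 - e) + e * ε) * r₂ ^ 2 * T
                / ((m : ℝ)⁻¹ ^ 2 * r₁ ^ 2)
                ≤ 324 * (δ + 2 * ε) * (m : ℝ) ^ 2 * r₂ ^ 2 * T / r₁ ^ 2 := by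
              calc _ ≤ 324 * (δ + 2 * ε) * r₂ ^ 2 * T / ((m : ℝ)⁻¹ ^ 2 * r₁ ^ 2) := by
                    gcongr
                    norm_num
                _ = _ := by field_simp
            have a3 : 9 / 2 * κ * CΛ * T / (m : ℝ)⁻¹ = 9 * κ * CΛ * m * T / 2 := by
              rw [div_inv_eq_mul]
              ring
            linarith)
      have hsk : s - (m : ℝ)⁻¹ = 3 - ((k + 1 : ℕ) : ℝ) * (m : ℝ)⁻¹ := by
        rw [hs]
        push_cast
        ring
      rw [hsk] at hΦ hΦmaps hf₂ hΦid hΦdisp hf₂ε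
      refine ⟨fun p => Ψ (Φ p), fun p => g₁ p + f₀ p, f₂, ?_⟩
      rintro D rfl
      have hsub := dom_mono (n := n) (N := N) (I₀ := I₀) hr₁.le hr₂.le hr₃.le
        (show 3 - ((k + 1 : ℕ) : ℝ) * (m : ℝ)⁻¹ ≤ s by
          rw [← hsk]
          have : 0 < (m : ℝ)⁻¹ := by positivity
          linarith)
      rw [pow_succ, ← he]
      refine ⟨hΨ.comp hΦ hΦmaps, hmaps.comp hΦmaps, (hg₁.add hf₀).mono hsub, hf₂,
        fun p hp => (hid _ (hΦmaps hp)).trans (hΦid p hp), fun p hp => ?_, fun p hp => ?_,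
        fun p hp => ?_, fun p hp => ?_⟩
      · have b1 := hdisp _ (hΦmaps hp)
        have b2 : ‖Φ p - p‖ ≤ 18 * m * r₂ / r₁ * ε * T * (e / 4) := by
          refine (hΦdisp p hp).trans_eq ?_
          field_simp
          norm_num
        have b3 : 0 ≤ 18 * m * r₂ / r₁ * ε * T * (e / 4) := by positivity
        have b4 := norm_add_le (Ψ (Φ p) - Φ p) (Φ p - p)
        rw [sub_add_sub_cancel] at b4
        refine b4.trans (le_trans (add_le_add b1 b2) ?_)
        linarith
      · have b1 := hg₁δ p (hsub hp)
        have b2 := hf₀ε p (hsub hp)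
        exact (norm_add_le _ _).trans (by linarith)
      · have b1 := hg₁h p (hsub hp)
        have b2 := hf₀h p (hsub hp)
        rw [poisson_linHam] at b1 b2 ⊢
        rw [fderiv_fun_add (hg₁.1 p (hsub hp)).differentiableAt
          (hf₀.1 p (hsub hp)).differentiableAt, add_apply, b1, b2, add_zero]
      · exact (hf₂ε p hp).trans (by linarith)
  obtain ⟨Ψ, g', f', h⟩ := key m le_rfl
  obtain ⟨h1, h2, h3, h4, h5, h6, h7, h8, h9⟩ := h _ rfl
  have hsub : (dom I₀ (2 * r₁) (2 * r₂) (2 * r₃) : Set (Phase n N)) ⊆ _ :=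
    dom_mono hr₁.le hr₂.le hr₃.le (show (2 : ℝ) ≤ 3 - m * (m : ℝ)⁻¹ by
      linarith [mul_inv_le_one (a := (m : ℝ))])
  have he : (0 : ℝ) ≤ (2 : ℝ)⁻¹ ^ m := by positivity
  refine ⟨Ψ, g', f', h1.mono hsub, h2.mono_left hsub, h3.mono hsub, h4.mono hsub,
    fun p hp => h5 p (hsub hp), fun p hp => (h6 p (hsub hp)).trans ?_,
    fun p hp => (h7 p (hsub hp)).trans ?_, fun p hp => h8 p (hsub hp), fun p hp => h9 p (hsub hp)⟩
  · have : 0 ≤ 18 * m * r₂ / r₁ * ε * T := by positivity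
    nlinarith
  · nlinarith
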